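/- **Setting.** Consider a finite-horizon MDP with state space $\mathcal X$ (a measurable space), finite action space $\mathcal Y$, horizon $H\ge 1$, initial distribution $\mu$, transition kernels $P_h$ and measurable rewards $r_h:\mathcal X\times\mathcal Y\to[0,R_{\max}]$, $h\in[H]=\{1,\dots,H\}$. For a policy $\pi$ let $J(\pi)$ be the expected return, $V^\pi_h,Q^\pi_h$ the value functions, $A^\pi_h(x,y)=Q^\pi_h(x,y)-V^\pi_h(x)$, $d^h_\pi$ the law of the state at time $h$ under $\pi$ started from $\mu$, and for a policy $\pi'$ let $$\mathbb A_{\pi,\mu}(\pi')=\frac1H\sum_{h=1}^H\mathbb E_{x\sim d^h_\pi}\,\mathbb E_{y\sim\pi'_h(\cdot\mid x)}[A^\pi_h(x,y)].$$ Let $\pi^+$ be a greedy policy, $\pi^+_h(x)\in\arg\max_y A^\pi_h(x,y)$. Fix $\tau>0$, let $\mathcal G_{h,\tau}=\{x:\max_y A^\pi_h(x,y)\ge\tau\}$ and $p_\pi=\frac1H\sum_{h}\mathbb P_{x\sim d^h_\pi}[x\in\mathcal G_{h,\tau}]$, and assume $p_\pi>0$. Let $$\mathbb A^{\mathcal G^c}_{\pi,\mu}(\pi')=\mathbb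 E[A^\pi_h(x,y)\mid x\notin\mathcal G_{h,\tau}],\qquad h\sim\mathrm{Unif}[H],\ x\sim d^h_\pi,\ y\sim\pi'_h(\cdot\mid x).$$ Let $\mathcal F$ be a finite class of measurable functions $\mathcal X\times\mathcal Y\times[H]\to\mathbb R$ that contains $(x,y,h)\mapsto Q^\pi_h(x,y)$. **Algorithm.** Draw $n$ independent samples $(x_i,h_i,y_i,\hat Q_i)$, where $(x_i,h_i)$ is drawn with $h\sim\mathrm{Unif}[H]$, $x\sim d^h_\pi$ in the variant CPI-RR, and from this law conditioned on $x\in\mathcal G_{h,\tau}$ in the variant CPI-CARO; $y_i\sim\mathrm{Unif}(\mathcal Y)$; and $\hat Q_i$ is the return collected from time $h_i$ on by a trajectory that starts with $(x_i,y_i)$ at time $h_i$ and then follows $\pi$ to the horizon. Let $\hat Q\in\arg\min_{f\in\mathcal F}\sum_i(f(x_i,y_i,h_i)-\hat Q_i)^2$ (any minimizer), $\hat\pi^+_h(x)\in\arg\max_y\hat Q(x,y,h)$ (with a measurable tie-breaking rule fixed in advance for every $f\in\mathcal F$), and $$\hat{\mathbb A}=\frac1n\sum_{i=1}^n|\mathcal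 Y|\bigl(\hat\pi^+_{h_i}(y_i\mid x_i)-\pi_{h_i}(y_i\mid x_i)\bigr)\hat Q(x_i,y_i,h_i).$$ CPI-RR sets $\hat\alpha=\min\{1,\hat{\mathbb A}/(H^2R_{\max})\}$ and returns $\pi_{\hat\alpha}=(1-\hat\alpha)\pi+\hat\alpha\hat\pi^+$ on all states. CPI-CARO sets $\hat\alpha=\min\{1,\hat{\mathbb A}/(2H^2R_{\max})\}$ and returns the policy $\pi_{\hat\alpha}$ that is $(1-\hat\alpha)\pi+\hat\alpha\hat\pi^+$ on $\mathcal G_{h,\tau}$ and $\pi$ on $\mathcal G_{h,\tau}^c$. **Theorem.** There is an absolute constant $C>0$ such that the following holds for every such instance and every $\delta\in(0,1)$, with $N_0:=C\,|\mathcal Y|\,H^2R_{\max}^2\log(2|\mathcal F|/\delta)$. (a) CPI-RR with $n\ge N_0/(\tau^2p_\pi^2)$ samples: with probability at least $1-\delta$, $\hat\alpha\in[0,1]$ and $$J(\pi_{\hat\alpha})-J(\pi)\ \ge\ \frac{\mathbb A_{\pi,\mu}(\pi^+)^2}{8HR_{\max}}\ \ge\ \frac{\tau^2p_\pi^2}{8HR_{\max}}.$$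 The second inequality is tight in the regime $\mathbb A^{\mathcal G^c}_{\pi,\mu}(\pi^+)\ll\tau$: for all $H\ge1$, $0<\tau\le R_{\max}$, $p\in(0,1)$ and $\varepsilon\in[0,1)$ there are an MDP (with two states and two actions) with rewards in $[0,R_{\max}]$ and a policy $\pi$ with $p_\pi=p$, $\mathbb A^{\mathcal G^c}_{\pi,\mu}(\pi^+)=\varepsilon\tau$ and $$\frac{\mathbb A_{\pi,\mu}(\pi^+)^2}{8HR_{\max}}=\Bigl(1+\varepsilon\,\frac{1-p}{p}\Bigr)^2\frac{\tau^2p^2}{8HR_{\max}},$$ so that equality holds for $\varepsilon=0$ and is approached as $\varepsilon\to0$. (b) CPI-CARO with $n\ge N_0/\tau^2$ samples: with probability at least $1-\delta$, $\hat\alpha\in[0,1]$ and $$J(\pi_{\hat\alpha})-J(\pi)\ \ge\ \frac{\tau^2p_\pi}{16HR_{\max}}.$$ -/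

import Mathlib

open MeasureTheory ProbabilityTheory
open scoped ENNReal

namespace CPI

noncomputable section

/-- A finite-horizon MDP with horizon `H`, initial distribution `init`, transition kernels
`trans h` and reward functions `reward h`. The time steps are `0, …, H - 1`, that is `Fin H`. -/
structure MDP (X Y : Type*) [MeasurableSpace X] [MeasurableSpace Y] (H : ℕ) where
  init : Measure X
  isProbabilityMeasure_init : IsProbabilityMeasure init
  trans : Fin H → Kernel (X × Y) X
  isMarkovKernel_trans : ∀ h, IsMarkovKernel (trans h)
  reward : Fin H → X → Y → ℝ
  measurable_reward : ∀ h, Measurable fun z : X × Y => reward h z.1 z.2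

/-- A (time-dependent, randomized) policy: `prob h x y` is the probability `π_h(y | x)`. -/
structure Policy (X Y : Type*) [MeasurableSpace X] [Fintype Y] (H : ℕ) where
  prob : Fin H → X → Y → ℝ
  prob_nonneg : ∀ h x y, 0 ≤ prob h x y
  sum_prob : ∀ h x, ∑ y, prob h x y = 1
  measurable_prob : ∀ h y, Measurable fun x => prob h x y

/-- A deterministic policy: at time `h` and state `x` it plays `act h x`. -/
structure DetPolicy (X Y : Type*) [MeasurableSpace X] [MeasurableSpace Y] (H : ℕ) where
  act : Fin H → X → Y
  measurable_act : ∀ h, Measurable (act h)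

/-- `d` is a greedy policy for `q`: `d_h(x) ∈ argmax_y q_h(x, y)`. -/
def IsGreedy {X Y : Type*} [MeasurableSpace X] [MeasurableSpace Y] {H : ℕ}
    (q : Fin H → X → Y → ℝ) (d : DetPolicy X Y H) : Prop :=
  ∀ h x y, q h x y ≤ q h x (d.act h x)

section Policies

variable {X Y : Type*} [MeasurableSpace X] [Fintype Y] [MeasurableSpace Y] {H : ℕ}

/-- The kernel `x ↦ π_h(· | x)`. -/
def Policy.kernel (π : Policy X Y H) (h : Fin H) : Kernel X Y where
  toFun x := ∑ y, ENNReal.ofReal (π.prob h x y) • Measure.dirac y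
  measurable' := by
    refine Measure.measurable_of_measurable_coe _ fun s _ => ?_
    simp only [Measure.coe_finsetSum, Finset.sum_apply, Measure.smul_apply, smul_eq_mul]
    exact Finset.measurable_sum _ fun y _ =>
      ((π.measurable_prob h y).ennreal_ofReal).mul_const _

open Classical in
/-- A deterministic policy, viewed as a policy. -/
def DetPolicy.toPolicy [MeasurableSingletonClass Y] (d : DetPolicy X Y H) : Policy X Y H where
  prob h x y := if y = d.act h x then 1 else 0
  prob_nonneg h x y := by split_ifs <;> norm_num
  sum_prob h x := by simp
  measurable_prob h y :=
    Measurable.ite (measurableSet_eq_fun measurable_const (d.measurable_act h))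
      measurable_const measurable_const

open Classical in
/-- The conservative mixture that plays `(1 - α) π + α π'` at the pairs `(h, x)` with `x ∈ S h`
and `π` at the other ones. -/
def Policy.mixOn (π π' : Policy X Y H) (S : Fin H → Set X) (hS : ∀ h, MeasurableSet (S h))
    (α : ℝ) (hα : α ∈ Set.Icc (0 : ℝ) 1) : Policy X Y H where
  prob h x y :=
    if x ∈ S h then (1 - α) * π.prob h x y + α * π'.prob h x y else π.prob h x y
  prob_nonneg h x y := by
    split_ifs
    · exact add_nonneg (mul_nonneg (sub_nonneg.2 hα.2) (π.prob_nonneg h x y))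
        (mul_nonneg hα.1 (π'.prob_nonneg h x y))
    · exact π.prob_nonneg h x y
  sum_prob h x := by
    split_ifs
    · rw [Finset.sum_add_distrib, ← Finset.mul_sum, ← Finset.mul_sum, π.sum_prob, π'.sum_prob]
      ring
    · exact π.sum_prob h x
  measurable_prob h y :=
    Measurable.ite (hS h)
      (((π.measurable_prob h y).const_mul _).add ((π'.measurable_prob h y).const_mul _))
      (π.measurable_prob h y)

end Policies

namespace MDP

variable {X Y : Type*} [MeasurableSpace X] [Fintype Y] [MeasurableSpace Y] {H : ℕ}

/-- If `κ x'` is the law of the return collected from time `h + 1` on when the state at that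
time is `x'`, then `M.actReturn h κ (x, y)` is the law of `r_h(x, y)` plus the return collected
from time `h + 1` on, where `x' ∼ P_h(· | x, y)`. -/
def actReturn (M : MDP X Y H) (h : Fin H) (κ : Kernel X ℝ) : Kernel (X × Y) ℝ :=
  (Kernel.id ×ₖ (κ ∘ₖ M.trans h)).map fun z => M.reward h z.1.1 z.1.2 + z.2

/-- `M.returnLaw π h x` is the law of the return `∑_{t ≥ h} r_t(x_t, y_t)` of the trajectory
that starts in `x` at time `h` and follows `π` to the horizon. -/
def returnLaw (M : MDP X Y H) (π : Policy X Y H) (h : ℕ) : Kernel X ℝ :=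
  if hh : h < H then
    M.actReturn ⟨h, hh⟩ (M.returnLaw π (h + 1)) ∘ₖ (Kernel.id ×ₖ π.kernel ⟨h, hh⟩)
  else Kernel.const X (Measure.dirac 0)
termination_by H - h

/-- The law of the output of a Q-rollout at `(x, y)` and time `h`: the return
`∑_{t ≥ h} r_t(x_t, y_t)` of the trajectory with `x_h = x`, `y_h = y` that follows `π` after
time `h`. -/
def qRollout (M : MDP X Y H) (π : Policy X Y H) (h : Fin H) : Kernel (X × Y) ℝ :=
  M.actReturn h (M.returnLaw π (h + 1))

/-- The objective `J(π)`: the expected return from `x_1 ∼ μ`. -/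
def J (M : MDP X Y H) (π : Policy X Y H) : ℝ :=
  ∫ z, z ∂(M.init.bind (M.returnLaw π 0))

/-- The value function (with value `0` for `h ≥ H`). -/
def V (M : MDP X Y H) (π : Policy X Y H) (h : ℕ) (x : X) : ℝ :=
  ∫ z, z ∂(M.returnLaw π h x)

/-- The action-value function. -/
def Q (M : MDP X Y H) (π : Policy X Y H) (h : Fin H) (x : X) (y : Y) : ℝ :=
  M.reward h x y + ∫ x', M.V π (h + 1) x' ∂(M.trans h (x, y))

/-- The advantage function. -/
def A (M : MDP X Y H) (π : Policy X Y H) (h : Fin H) (x : X) (y : Y) : ℝ :=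
  M.Q π h x y - M.V π h x

/-- The law of the state at time `h ≤ H` under `π` with `x_1 ∼ μ`. -/
def stateLaw (M : MDP X Y H) (π : Policy X Y H) : ℕ → Measure X
  | 0 => M.init
  | h + 1 =>
    if hh : h < H then
      (M.stateLaw π h).bind (M.trans ⟨h, hh⟩ ∘ₖ (Kernel.id ×ₖ π.kernel ⟨h, hh⟩))
    else 0

/-- The on-policy law of `(h, x)`: `h ∼ Unif[H]` and `x ∼ d_π^h`. -/
def onPolicy (M : MDP X Y H) (π : Policy X Y H) : Measure (Fin H × X) :=
  (H : ℝ≥0∞)⁻¹ • ∑ h : Fin H, (M.stateLaw π h).map (Prod.mk h)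

/-- The policy advantage of `π'` against `π`. -/
def policyAdvantage (M : MDP X Y H) (π π' : Policy X Y H) : ℝ :=
  (1 / (H : ℝ)) * ∑ h : Fin H, ∫ x, ∑ y, π'.prob h x y * M.A π h x y ∂(M.stateLaw π h)

/-- The `τ`-improvable set at time `h`: the states with `max_y A_h^π(x, y) ≥ τ`. -/
def improvable (M : MDP X Y H) (π : Policy X Y H) (τ : ℝ) (h : Fin H) : Set X :=
  {x | ∃ y, τ ≤ M.A π h x y}

/-- The coverage of `π` at threshold `τ`. -/
def coverage (M : MDP X Y H) (π : Policy X Y H) (τ : ℝ) : ℝ :=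
  (1 / (H : ℝ)) * ∑ h : Fin H, (M.stateLaw π h).real (M.improvable π τ h)

/-- The pairs `(h, x)` such that `x` is `τ`-improvable at time `h`. -/
def improvablePairs (M : MDP X Y H) (π : Policy X Y H) (τ : ℝ) : Set (Fin H × X) :=
  {z | z.2 ∈ M.improvable π τ z.1}

/-- The credit sampler: the on-policy law of `(h, x)`, conditioned on `x` being improvable at
time `h`. -/
def creditSampler (M : MDP X Y H) (π : Policy X Y H) (τ : ℝ) : Measure (Fin H × X) :=
  cond (M.onPolicy π) (M.improvablePairs π τ)

/-- The conditional policy advantage of `π'` off the improvable set: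
`E[A_h^π(x, y) | x ∉ G_{h,τ}]` for `h ∼ Unif[H]`, `x ∼ d_π^h`, `y ∼ π'_h(· | x)`. -/
def offAdvantage (M : MDP X Y H) (π π' : Policy X Y H) (τ : ℝ) : ℝ :=
  ∫ z, ∑ y, π'.prob z.1 z.2 y * M.A π z.1 z.2 y
    ∂(cond (M.onPolicy π) (M.improvablePairs π τ)ᶜ)

/-- The Q-rollouts at all times, as one kernel. -/
def rolloutKernel (M : MDP X Y H) (π : Policy X Y H) : Kernel ((Fin H × X) × Y) ℝ where
  toFun z := M.qRollout π z.1.1 (z.1.2, z.2)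
  measurable' := by
    have hm : Measurable fun w : Fin H × (X × Y) => M.qRollout π w.1 w.2 :=
      measurable_from_prod_countable_right fun h => (M.qRollout π h).measurable
    exact hm.comp (f := fun z : (Fin H × X) × Y => (z.1.1, (z.1.2, z.2))) (by fun_prop)

/-- The law of one sample `((h_i, x_i), y_i, Q̂_i)`: `(h_i, x_i) ∼ ν`, then
`y_i ∼ Unif(Y)`, then a Q-rollout of `π`. -/
def sampleLaw (M : MDP X Y H) (π : Policy X Y H) (ν : Measure (Fin H × X)) :
    Measure (((Fin H × X) × Y) × ℝ) :=
  (ν.prod (uniformOn (Set.univ : Set Y))) ⊗ₘ M.rolloutKernel π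

/-- The law of `n` independent samples. -/
def dataLaw (M : MDP X Y H) (π : Policy X Y H) (ν : Measure (Fin H × X)) (n : ℕ) :
    Measure (Fin n → ((Fin H × X) × Y) × ℝ) :=
  Measure.pi fun _ => M.sampleLaw π ν

theorem measurable_V (M : MDP X Y H) (π : Policy X Y H) (h : ℕ) : Measurable (M.V π h) :=
  (StronglyMeasurable.integral_kernel (κ := M.returnLaw π h) stronglyMeasurable_id).measurable

theorem measurable_A [MeasurableSingletonClass Y] (M : MDP X Y H) (π : Policy X Y H)
    (h : Fin H) (y : Y) : Measurable fun x => M.A π h x y := by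
  have h1 : Measurable fun z : X × Y => ∫ x', M.V π (h + 1) x' ∂(M.trans h z) :=
    (StronglyMeasurable.integral_kernel (κ := M.trans h)
      (M.measurable_V π (h + 1)).stronglyMeasurable).measurable
  exact (((M.measurable_reward h).comp measurable_prodMk_right).add
    (h1.comp measurable_prodMk_right)).sub (M.measurable_V π h)

theorem measurableSet_improvable [MeasurableSingletonClass Y] (M : MDP X Y H)
    (π : Policy X Y H) (τ : ℝ) (h : Fin H) : MeasurableSet (M.improvable π τ h) := by
  have : M.improvable π τ h = ⋃ y, {x | τ ≤ M.A π h x y} := by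
    ext x; simp [improvable]
  rw [this]
  exact MeasurableSet.iUnion fun y => measurableSet_le measurable_const (M.measurable_A π h y)

end MDP

section Algorithm

variable {X Y : Type*} [MeasurableSpace X] [Fintype Y] [MeasurableSpace Y] {H : ℕ}

/-- The empirical squared loss `∑_i (f(x_i, y_i, h_i) - Q̂_i)²`. -/
def empiricalLoss {n : ℕ} (f : Fin H → X → Y → ℝ) (D : Fin n → ((Fin H × X) × Y) × ℝ) : ℝ :=
  ∑ i, (f (D i).1.1.1 (D i).1.1.2 (D i).1.2 - (D i).2) ^ 2

/-- `f` is a least-squares fit in the class `F` to the data `D`. -/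
def IsLeastSquares {n : ℕ} (F : Finset (Fin H → X → Y → ℝ))
    (D : Fin n → ((Fin H × X) × Y) × ℝ) (f : Fin H → X → Y → ℝ) : Prop :=
  f ∈ F ∧ ∀ g ∈ F, empiricalLoss f D ≤ empiricalLoss g D

/-- The advantage estimate
`(1/n) ∑_i |Y| (π̂_{h_i}(y_i | x_i) - π_{h_i}(y_i | x_i)) f(x_i, y_i, h_i)`. -/
def advEstimate {n : ℕ} (π πhat : Policy X Y H) (f : Fin H → X → Y → ℝ)
    (D : Fin n → ((Fin H × X) × Y) × ℝ) : ℝ :=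
  (1 / (n : ℝ)) * ∑ i, (Fintype.card Y : ℝ) *
    (πhat.prob (D i).1.1.1 (D i).1.1.2 (D i).1.2 - π.prob (D i).1.1.1 (D i).1.1.2 (D i).1.2) *
      f (D i).1.1.1 (D i).1.1.2 (D i).1.2

/-- The step size of CPI with random resets. -/
def stepRR {n : ℕ} (R : ℝ) (π πhat : Policy X Y H) (f : Fin H → X → Y → ℝ)
    (D : Fin n → ((Fin H × X) × Y) × ℝ) : ℝ :=
  min 1 (advEstimate π πhat f D / ((H : ℝ) ^ 2 * R))

/-- The step size of CPI with the credit-assignment reset oracle. -/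
def stepCARO {n : ℕ} (R : ℝ) (π πhat : Policy X Y H) (f : Fin H → X → Y → ℝ)
    (D : Fin n → ((Fin H × X) × Y) × ℝ) : ℝ :=
  min 1 (advEstimate π πhat f D / (2 * (H : ℝ) ^ 2 * R))

variable [MeasurableSingletonClass Y]

/-- The policy returned by CPI with random resets: `(1 - α) π + α π̂` on all states. -/
def outputRR (π πhat : Policy X Y H) (α : ℝ) (hα : α ∈ Set.Icc (0 : ℝ) 1) : Policy X Y H :=
  π.mixOn πhat (fun _ => Set.univ) (fun _ => MeasurableSet.univ) α hα

/-- The policy returned by CPI with the credit-assignment reset oracle: `(1 - α) π + α π̂` on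
the improvable sets and `π` off them. -/
def outputCARO (M : MDP X Y H) (τ : ℝ) (π πhat : Policy X Y H) (α : ℝ)
    (hα : α ∈ Set.Icc (0 : ℝ) 1) : Policy X Y H :=
  π.mixOn πhat (M.improvable π τ) (M.measurableSet_improvable π τ) α hα

end Algorithm

/-- The sample-size constant `N₀ = C |Y| H² R² log(2|F|/δ)`, where `k = |Y|` and `m = |F|`. -/
def N₀ (C : ℝ) (k H : ℕ) (R : ℝ) (m : ℕ) (δ : ℝ) : ℝ :=
  C * k * (H : ℝ) ^ 2 * R ^ 2 * Real.log (2 * m / δ)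

end

end CPI

open CPI

set_option linter.unusedSectionVars false

-- The proof has a control half and a statistical half. They meet in one quantity, the advantage of
-- the fitted greedy policy under the law from which (h, x) is sampled.
--
-- Control. By the performance difference lemma (`J_sub_J_eq_sum`), the gain of a mixture is the sum
-- over h of its π-advantages under its own state laws. Mixing with weight α on sets S_h turns these
-- advantages into α times those of the greedy policy on S_h and zero elsewhere, because π has zero
-- mean advantage against itself. Replacing the state law at time h by that of π costs at most 2α(H
-- - h)R times the π-mass of S at earlier times (`abs_integral_stateLaw_mixOn_sub_le`), with one
-- more factor α from the advantage itself. Hence `le_J_mixOn_sub_J`: a term linear in α minus a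
-- term quadratic in α. On all states the penalty is at most α²RH³/2. On the improvable sets the
-- earlier masses add up to at most H p_π, so it is at most α²RH³p_π. Linear and quadratic terms
-- then carry the same factor p_π, which is why the credit-assignment variant loses p_π only once.
-- The step sizes are proportional to an estimate of the advantage, and `sq_le_of_step` converts an
-- accurate estimate into a gain quadratic in the advantage.
--
-- Statistics. Put B = HR. Since Q lies in the class, the squared-loss comparison and a
-- self-normalized Hoeffding bound give a squared error of order B² log(|F|/δ), first on the sample
-- and then in the population (`exists_regression_event`). If n is of order |Y|B² log(|F|/δ)/ε², the
-- importance-weighted estimate is within ε/16 of the true advantage and the fitted greedy policy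
-- within ε/16 of the best one. With ε = τp_π for on-policy sampling and ε = τ for the credit
-- sampler, ε is at most the advantage of the true greedy policy, so both errors are relative.
--
-- Tightness. In a two-state MDP with absorbing states and a policy that earns nothing, the
-- advantages are the rewards, and every quantity is explicit.

namespace CPI

/-! ### Exponential moments and union bounds. -/

section Concentration

variable {Ω : Type*} [MeasurableSpace Ω] {P : Measure Ω} [IsProbabilityMeasure P]

/-- Chernoff bound for the sum of `n` independent copies of `φ` when `E[exp φ] ≤ 1`. -/
theorem measureReal_sum_ge_le_exp_neg {φ : Ω → ℝ} (hφ : Measurable φ)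
    (h : ∫⁻ ω, ENNReal.ofReal (Real.exp (φ ω)) ∂P ≤ 1) (n : ℕ) (l : ℝ) :
    (Measure.pi fun _ : Fin n => P).real {ω | l ≤ ∑ i, φ (ω i)} ≤ Real.exp (-l) := by
  have hm : Measurable fun ω => Real.exp (φ ω) := hφ.exp
  have hint : Integrable (fun ω => Real.exp (φ ω)) P := by
    refine ⟨hm.aestronglyMeasurable, ?_⟩
    rw [hasFiniteIntegral_iff_ofReal (Filter.Eventually.of_forall fun ω => (Real.exp_pos _).le)]
    exact h.trans_lt ENNReal.one_lt_top
  have hle : ∫ ω, Real.exp (φ ω) ∂P ≤ 1 := by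
    rw [integral_eq_lintegral_of_nonneg_ae
      (Filter.Eventually.of_forall fun ω => (Real.exp_pos _).le) hm.aestronglyMeasurable]
    exact ENNReal.toReal_le_of_le_ofReal zero_le_one (by simpa using h)
  have hprod : ∫ ω : Fin n → Ω, ∏ i, Real.exp (φ (ω i)) ∂(Measure.pi fun _ => P) ≤ 1 := by
    rw [integral_fintype_prod_eq_pow (fun ω => Real.exp (φ ω))]
    exact pow_le_one₀ (integral_nonneg fun ω => (Real.exp_pos _).le) hle
  have hpint : Integrable (fun ω : Fin n → Ω => ∏ i, Real.exp (φ (ω i)))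
      (Measure.pi fun _ => P) := Integrable.fintype_prod fun _ => hint
  have hmk := mul_meas_ge_le_integral_of_nonneg
    (Filter.Eventually.of_forall fun ω : Fin n → Ω =>
      Finset.prod_nonneg fun i _ => (Real.exp_pos (φ (ω i))).le) hpint (Real.exp l)
  have hset : {ω : Fin n → Ω | l ≤ ∑ i, φ (ω i)}
      = {ω | Real.exp l ≤ ∏ i, Real.exp (φ (ω i))} := by
    ext ω
    simp [← Real.exp_sum]
  rw [hset, Real.exp_neg, ← one_div, le_div_iff₀ (Real.exp_pos l), mul_comm]
  exact hmk.trans hprod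

/-- Integrate the pointwise bound and use 1 + m ≤ exp m. All exponents that do not involve the
rollout noise are normalized this way. -/
theorem lintegral_exp_sub_integral_le_one {U V : Ω → ℝ} (hV : Integrable V P)
    (h : ∀ ω, Real.exp (U ω) ≤ 1 + V ω) :
    ∫⁻ ω, ENNReal.ofReal (Real.exp (U ω - ∫ ω', V ω' ∂P)) ∂P ≤ 1 := by
  set m := ∫ ω', V ω' ∂P with hmdef
  calc ∫⁻ ω, ENNReal.ofReal (Real.exp (U ω - m)) ∂P
      ≤ ∫⁻ ω, ENNReal.ofReal ((1 + V ω) * Real.exp (-m)) ∂P := by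
        refine lintegral_mono fun ω => ENNReal.ofReal_le_ofReal ?_
        rw [sub_eq_add_neg, Real.exp_add]
        exact mul_le_mul_of_nonneg_right (h ω) (Real.exp_pos _).le
    _ = ENNReal.ofReal (∫ ω, (1 + V ω) * Real.exp (-m) ∂P) := by
        refine (ofReal_integral_eq_lintegral_ofReal (((integrable_const 1).add hV).mul_const _)
          (Filter.Eventually.of_forall fun ω => ?_)).symm
        exact mul_nonneg ((Real.exp_pos _).le.trans (h ω)) (Real.exp_pos _).le
    _ ≤ 1 := by
        rw [integral_mul_const, integral_add (integrable_const 1) hV]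
        simp only [integral_const, probReal_univ, smul_eq_mul, one_mul, ← hmdef]
        rw [ENNReal.ofReal_le_one, Real.exp_neg, ← div_eq_mul_inv, div_le_one (Real.exp_pos m)]
        linarith [Real.add_one_le_exp m]

/-- On [-1, 0] the convex function exp lies below its chord, and exp(-1) ≤ 1/2. -/
theorem exp_neg_le_one_sub_half {x : ℝ} (h0 : 0 ≤ x) (h1 : x ≤ 1) :
    Real.exp (-x) ≤ 1 - x / 2 := by
  have h := convexOn_exp.2 (Set.mem_univ (-1 : ℝ)) (Set.mem_univ 0) h0 (sub_nonneg.2 h1)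
    (by ring)
  have h2 : Real.exp (-1) ≤ 1 / 2 := by
    rw [Real.exp_neg, ← one_div]
    exact one_div_le_one_div_of_le two_pos (by linarith [Real.add_one_le_exp 1])
  simp only [smul_eq_mul, mul_neg, mul_one, mul_zero, add_zero, Real.exp_zero] at h
  nlinarith

theorem exp_le_one_add_two_mul {x : ℝ} (h0 : 0 ≤ x) (h1 : x ≤ 1) :
    Real.exp x ≤ 1 + 2 * x := by
  have h := abs_le.1 (Real.abs_exp_sub_one_sub_id_le (x := x) (by rwa [abs_of_nonneg h0]))
  nlinarith [h.2]

theorem exp_le_one_add_add_sq {x : ℝ} (h : |x| ≤ 1) : Real.exp x ≤ 1 + (x + x ^ 2) := by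
  linarith [(abs_le.1 (Real.abs_exp_sub_one_sub_id_le h)).2]

/-- Hoeffding's lemma for a law on `[0, B]`, self-normalized by the multiplier `u`. -/
theorem lintegral_exp_noise_le_one {ρ : Measure ℝ} [IsProbabilityMeasure ρ] {B : ℝ} (hB : 0 < B)
    (hρ : ∀ᵐ r ∂ρ, r ∈ Set.Icc 0 B) (u : ℝ) :
    ∫⁻ r, ENNReal.ofReal (Real.exp
      ((2 * (r - ∫ r', r' ∂ρ) * u - u ^ 2 / 2) / B ^ 2)) ∂ρ ≤ 1 := by
  -- The variance proxy is (B/2)². At the parameter 2u/B² the moment bound is exp(u²/(2B²)), exactly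
  -- what the subtracted u²/2 cancels. No bound on u is needed, so the fitted functions may be
  -- unbounded.
  have hs := hasSubgaussianMGF_of_mem_Icc (X := id) (μ := ρ) aemeasurable_id hρ
  have hle := hs.mgf_le (2 * u / B ^ 2)
  have hint := hs.integrable_exp_mul (2 * u / B ^ 2)
  simp only [mgf, id] at hle hint
  have heq : ∀ r : ℝ, Real.exp ((2 * (r - ∫ r', r' ∂ρ) * u - u ^ 2 / 2) / B ^ 2)
      = Real.exp (-(u ^ 2 / (2 * B ^ 2))) * Real.exp (2 * u / B ^ 2 * (r - ∫ r', r' ∂ρ)) := by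
    intro r
    rw [← Real.exp_add]; congr 1; field_simp; ring
  simp_rw [heq]
  rw [← ofReal_integral_eq_lintegral_ofReal (hint.const_mul _)
    (Filter.Eventually.of_forall fun r => by positivity), integral_const_mul,
    ENNReal.ofReal_le_one]
  calc _ ≤ Real.exp (-(u ^ 2 / (2 * B ^ 2))) * _ :=
        mul_le_mul_of_nonneg_left hle (Real.exp_pos _).le
    _ = 1 := by
        rw [← Real.exp_add, Real.exp_eq_one_iff]
        simp
        rw [abs_of_pos hB]
        field_simp
        ring

/-- Simultaneous Chernoff bounds. -/
theorem exists_event_sum_lt {J : Type*} (T : Finset J) {φ : J → Ω → ℝ}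
    (hφ : ∀ j ∈ T, Measurable (φ j))
    (h : ∀ j ∈ T, ∫⁻ ω, ENNReal.ofReal (Real.exp (φ j ω)) ∂P ≤ 1) (n : ℕ) {l δ : ℝ}
    (hl : T.card * Real.exp (-l) ≤ δ) :
    ∃ E : Set (Fin n → Ω), MeasurableSet E ∧
      1 - δ ≤ (Measure.pi fun _ : Fin n => P).real E ∧
      ∀ D ∈ E, ∀ j ∈ T, ∑ i, φ j (D i) < l := by
  have hms : ∀ j ∈ T, MeasurableSet {D : Fin n → Ω | l ≤ ∑ i, φ j (D i)} := fun j hj =>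
    measurableSet_le measurable_const (Finset.measurable_sum _ fun i _ =>
      (hφ j hj).comp (measurable_pi_apply i))
  have hU : MeasurableSet (⋃ j ∈ T, {D : Fin n → Ω | l ≤ ∑ i, φ j (D i)}) :=
    Finset.measurableSet_biUnion T hms
  refine ⟨(⋃ j ∈ T, {D : Fin n → Ω | l ≤ ∑ i, φ j (D i)})ᶜ, hU.compl, ?_, ?_⟩
  · rw [probReal_compl_eq_one_sub hU]
    have h1 := measureReal_biUnion_finset_le (μ := Measure.pi fun _ : Fin n => P) T
      (fun j => {D : Fin n → Ω | l ≤ ∑ i, φ j (D i)})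
    have h2 := Finset.sum_le_sum fun j hj =>
      measureReal_sum_ge_le_exp_neg (P := P) (hφ j hj) (h j hj) n l
    rw [Finset.sum_const, nsmul_eq_mul] at h2
    linarith
  · intro D hD j hj
    simp only [Set.mem_compl_iff, Set.mem_iUnion, Set.mem_ofPred_eq, not_exists, not_le] at hD
    exact hD j hj

end Concentration

/-! ### Integrals against uniformly drawn actions. -/

section Uniform

variable {S Y : Type*} [MeasurableSpace S] [Fintype Y] [MeasurableSpace Y]
  [MeasurableSingletonClass Y]

theorem integral_uniformOn_univ [Nonempty Y] (g : Y → ℝ) :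
    ∫ y, g y ∂(uniformOn (Set.univ : Set Y)) = (Fintype.card Y : ℝ)⁻¹ * ∑ y, g y := by
  rw [integral_fintype (Integrable.of_finite), Finset.mul_sum]
  refine Finset.sum_congr rfl fun y _ => ?_
  congr 1
  simp [Measure.real, uniformOn, cond_apply, ENat.card_eq_coe_fintype_card,
    ENNReal.toReal_inv, Measure.count_univ]

theorem integral_prod_uniformOn [Nonempty Y] (ν : Measure S) [IsProbabilityMeasure ν]
    {g : S × Y → ℝ} (hg : Measurable g) {c : ℝ} (hc : ∀ z, |g z| ≤ c) :
    ∫ z, g z ∂(ν.prod (uniformOn (Set.univ : Set Y)))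
      = (Fintype.card Y : ℝ)⁻¹ * ∫ s, ∑ y, g (s, y) ∂ν := by
  have : IsProbabilityMeasure (uniformOn (Set.univ : Set Y)) :=
    isProbabilityMeasure_uniformOn Set.finite_univ Set.univ_nonempty
  rw [integral_prod g (Integrable.of_bound hg.aestronglyMeasurable c
    (Filter.Eventually.of_forall hc))]
  simp_rw [integral_uniformOn_univ, integral_const_mul]

end Uniform

/-! ### From concentration inequalities to the error of the advantage estimate. -/

section Deterministic

variable {Z : Type*} {n : ℕ}

/-- Deterministic consequence of the five concentration inequalities: the error of the plug-in
advantage estimate on the sample. -/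
theorem abs_advantage_error_le {z : Fin n → Z} {r : Fin n → ℝ} {f q W : Z → ℝ}
    {k B ε l a : ℝ} (hk : 1 ≤ k) (hB : 0 < B) (hε : 0 < ε) (hεB : ε ≤ B) (hn : 0 < n)
    (hN : 2 ^ 20 * k * B ^ 2 * l ≤ ε ^ 2 * n)
    (h1 : ∑ i, (f (z i) - r i) ^ 2 ≤ ∑ i, (q (z i) - r i) ^ 2)
    (h2 : ∑ i, (2 * (r i - q (z i)) * (f (z i) - q (z i)) - (f (z i) - q (z i)) ^ 2 / 2) / B ^ 2
      < l)
    (h3 : ∑ i, (W (z i) ^ 2 - 4 / k) < l)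
    (h4 : ∑ i, (ε / (128 * k * B ^ 2) * (k * W (z i) * q (z i) - a)
      - 2 * (ε / (128 * k * B ^ 2)) ^ 2 * (k * B ^ 2)) < l)
    (h5 : ∑ i, (-(ε / (128 * k * B ^ 2)) * (k * W (z i) * q (z i) - a)
      - 2 * (ε / (128 * k * B ^ 2)) ^ 2 * (k * B ^ 2)) < l) :
    ∑ i, (f (z i) - q (z i)) ^ 2 ≤ 2 * B ^ 2 * l ∧
      |(1 / (n : ℝ)) * ∑ i, k * W (z i) * f (z i) - a| ≤ ε / 16 := by
  have hn' : (0 : ℝ) < n := Nat.cast_pos.2 hn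
  have hk0 : 0 < k := by linarith
  set A := ∑ i, (f (z i) - q (z i)) ^ 2 with hA
  have hA2 : A ≤ 2 * B ^ 2 * l := by
    rw [← Finset.sum_div, div_lt_iff₀ (by positivity), Finset.sum_sub_distrib,
      ← Finset.sum_div, ← hA] at h2
    -- The loss comparison becomes A ≤ ∑ 2(r - q)(f - q), while `h2` bounds the right side by B²l +
    -- A/2.
    have e1 : ∑ i, (f (z i) - r i) ^ 2 = A - ∑ i, 2 * (r i - q (z i)) * (f (z i) - q (z i))
        + ∑ i, (q (z i) - r i) ^ 2 := by
      rw [hA, ← Finset.sum_sub_distrib, ← Finset.sum_add_distrib]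
      exact Finset.sum_congr rfl fun i _ => by ring
    linarith
  refine ⟨hA2, ?_⟩
  have hA0 : 0 ≤ A := Finset.sum_nonneg fun i _ => sq_nonneg _
  have hl0 : 0 ≤ l := by
    have : 0 ≤ B ^ 2 * l := by linarith
    exact nonneg_of_mul_nonneg_right this (by positivity)
  set x := k * B ^ 2 * l with hx
  have hx0 : 0 ≤ x := by positivity
  have hkl : k * l ≤ n := by
    have : ε ^ 2 * (k * l) ≤ ε ^ 2 * n := by
      have : ε ^ 2 * (k * l) ≤ B ^ 2 * (k * l) :=
        mul_le_mul_of_nonneg_right (pow_le_pow_left₀ hε.le hεB 2) (by positivity)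
      nlinarith
    exact le_of_mul_le_mul_left this (by positivity)
  set v := ∑ i, W (z i) ^ 2 with hv
  have hv2 : k * v ≤ 5 * n := by
    rw [Finset.sum_sub_distrib, ← hv] at h3
    simp only [Finset.sum_const, Finset.card_univ, Fintype.card_fin, nsmul_eq_mul] at h3
    have := mul_lt_mul_of_pos_left h3 hk0
    have e : k * (v - n * (4 / k)) = k * v - 4 * n := by field_simp
    linarith
  set s := ∑ i, (k * W (z i) * q (z i) - a) with hs
  set t := ε / (128 * k * B ^ 2) with ht
  have ht0 : 0 < t := by positivity
  have htk : t * (k * B ^ 2) = ε / 128 := by rw [ht]; field_simp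
  have hs1 : t * s ≤ l + n * (t * ε / 64) := by
    rw [Finset.sum_sub_distrib, ← Finset.mul_sum, ← hs] at h4
    simp only [Finset.sum_const, Finset.card_univ, Fintype.card_fin, nsmul_eq_mul] at h4
    have : 2 * t ^ 2 * (k * B ^ 2) = t * ε / 64 := by
      linear_combination 2 * t * htk
    rw [this] at h4; linarith
  have hs2 : -(t * s) ≤ l + n * (t * ε / 64) := by
    rw [Finset.sum_sub_distrib, ← Finset.mul_sum, ← hs] at h5
    simp only [Finset.sum_const, Finset.card_univ, Fintype.card_fin, nsmul_eq_mul] at h5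
    have : 2 * t ^ 2 * (k * B ^ 2) = t * ε / 64 := by
      linear_combination 2 * t * htk
    rw [this] at h5; linarith
  have hlt : l ≤ t * (ε * n / 2 ^ 13) := by
    have : t * (ε * n / 2 ^ 13) = ε ^ 2 * n / (2 ^ 20 * k * B ^ 2) := by
      rw [ht]; field_simp; norm_num
    rw [this, le_div_iff₀ (by positivity)]
    linarith
  -- The estimate with q in place of f concentrates by the two-sided Bernstein bounds `h4` and `h5`.
  -- The remainder w, coming from f - q, is then handled by weighted AM-GM: ∑ W² is only of order
  -- n/k, which saves a factor k over the crude bound |W| ≤ 1.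
  have hsb : |s| ≤ n * ε * (1 / 2 ^ 13 + 1 / 64) := by
    rw [abs_le]
    constructor <;> refine le_of_mul_le_mul_left ?_ ht0 <;> nlinarith
  set w := ∑ i, k * W (z i) * (f (z i) - q (z i)) with hw
  have hwb : |w| ≤ n * ε * (1 / 2 ^ 13 + 5 / 256) := by
    have hp : ∀ i, |k * W (z i) * (f (z i) - q (z i))| ≤
        ε / 256 * (k * W (z i) ^ 2) + k * (64 / ε) * (f (z i) - q (z i)) ^ 2 := by
      intro i
      have key : ∀ c d : ℝ, k * c * d ≤ ε / 256 * (k * c ^ 2) + k * (64 / ε) * d ^ 2 := by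
        intro c d
        have : ε / 256 * (k * c ^ 2) + k * (64 / ε) * d ^ 2 - k * c * d
            = k / (256 * ε) * (ε * c - 128 * d) ^ 2 := by field_simp; ring
        have : 0 ≤ k / (256 * ε) * (ε * c - 128 * d) ^ 2 := by positivity
        linarith
      rw [abs_le]
      constructor
      · have := key (-W (z i)) (f (z i) - q (z i))
        rw [neg_sq] at this; linarith
      · exact key _ _
    have h6 : |w| ≤ ε / 256 * (k * v) + k * (64 / ε) * A := by
      refine (Finset.abs_sum_le_sum_abs _ _).trans ((Finset.sum_le_sum fun i _ => hp i).trans ?_)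
      rw [Finset.sum_add_distrib, ← Finset.mul_sum, ← Finset.mul_sum, ← Finset.mul_sum]
    have h7 : k * (64 / ε) * A ≤ n * ε * (1 / 2 ^ 13) := by
      calc k * (64 / ε) * A ≤ k * (64 / ε) * (2 * B ^ 2 * l) :=
            mul_le_mul_of_nonneg_left hA2 (by positivity)
        _ = 128 / ε * x := by rw [hx]; ring
        _ ≤ 128 / ε * (ε ^ 2 * n / 2 ^ 20) :=
            mul_le_mul_of_nonneg_left (by linarith) (by positivity)
        _ = n * ε * (1 / 2 ^ 13) := by field_simp; norm_num
    have h8 : ε / 256 * (k * v) ≤ ε / 256 * (5 * n) :=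
      mul_le_mul_of_nonneg_left hv2 (by positivity)
    nlinarith
  have hfin : (1 / (n : ℝ)) * ∑ i, k * W (z i) * f (z i) - a = (s + w) / n := by
    have : s + w = ∑ i, k * W (z i) * f (z i) - n * a := by
      rw [hs, hw, ← Finset.sum_add_distrib]
      rw [eq_sub_iff_add_eq]
      have : (n : ℝ) * a = ∑ _i : Fin n, a := by simp
      rw [this, ← Finset.sum_add_distrib]
      exact Finset.sum_congr rfl fun i _ => by ring
    rw [this]; field_simp
  rw [hfin, abs_div, abs_of_pos hn', div_le_iff₀ hn']
  -- The budget closes since 2/2^13 + 1/64 + 5/256 ≤ 1/16.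
  have := abs_add_le s w
  nlinarith [mul_pos hn' hε]

end Deterministic

/-! ### Uniform guarantees for least squares over a finite class. -/

section Regression

variable {S Y : Type*} [MeasurableSpace S] [Fintype Y] [MeasurableSpace Y]
  [MeasurableSingletonClass Y]

/-- The signed weight `1{y = d(s)} - p(y | s)`. -/
noncomputable def actWeight (d : S → Y) (p : S × Y → ℝ) (z : S × Y) : ℝ :=
  open Classical in (if z.2 = d z.1 then 1 else 0) - p z

/-- Truncation of a function to `[0, B]`. -/
noncomputable def clip (B : ℝ) (f : S × Y → ℝ) (z : S × Y) : ℝ := max 0 (min B (f z))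

theorem clip_mem {B : ℝ} (hB : 0 ≤ B) (f : S × Y → ℝ) (z : S × Y) :
    clip B f z ∈ Set.Icc 0 B :=
  ⟨le_max_left _ _, max_le hB (min_le_left _ _)⟩

theorem abs_clip_sub_le {B : ℝ} (f : S × Y → ℝ) {z : S × Y} {x : ℝ} (hx : x ∈ Set.Icc 0 B) :
    |clip B f z - x| ≤ |f z - x| := by
  have h1 := abs_max_sub_max_le_abs (min B (f z)) x 0
  have h2 := abs_min_sub_min_le_max B (f z) B x
  rw [max_eq_left hx.1] at h1
  rw [sub_self, abs_zero, max_eq_right (abs_nonneg _), min_eq_right hx.2] at h2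
  rw [clip, max_comm]
  exact h1.trans h2

theorem measurable_clip {B : ℝ} {f : S × Y → ℝ} (hf : Measurable f) : Measurable (clip B f) :=
  measurable_const.max (measurable_const.min hf)

theorem measurable_actWeight {d : S → Y} (hd : Measurable d) {p : S × Y → ℝ}
    (hp : Measurable p) : Measurable (actWeight d p) := by
  refine Measurable.sub (Measurable.ite ?_ measurable_const measurable_const) hp
  have : {z : S × Y | z.2 = d z.1} = ⋃ y, {z : S × Y | z.2 = y} ∩ {z | d z.1 = y} := by
    ext z; simp [eq_comm]
  rw [this]
  exact MeasurableSet.iUnion fun y => (measurable_snd (measurableSet_singleton y)).inter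
    ((hd.comp measurable_fst) (measurableSet_singleton y))

variable {p : S × Y → ℝ}

theorem abs_actWeight_le (d : S → Y) (hp0 : ∀ z, 0 ≤ p z) (hp1 : ∀ s, ∑ y, p (s, y) = 1)
    (z : S × Y) : |actWeight d p z| ≤ 1 := by
  have h1 : p z ≤ 1 := by
    rw [← hp1 z.1]
    exact Finset.single_le_sum (f := fun y => p (z.1, y)) (fun y _ => hp0 _) (Finset.mem_univ z.2)
  have h0 := hp0 z
  rw [abs_le, actWeight]
  split_ifs <;> constructor <;> linarith

/-- As |W| ≤ 1, each W² is at most 1{y = d(s)} + p(y | s). Under a uniform action, k·W thus has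
second moment at most 2k instead of k². -/
theorem sum_actWeight_sq_le (d : S → Y) (hp0 : ∀ z, 0 ≤ p z) (hp1 : ∀ s, ∑ y, p (s, y) = 1)
    (s : S) : ∑ y, actWeight d p (s, y) ^ 2 ≤ 2 := by
  classical
  have h : ∀ y, actWeight d p (s, y) ^ 2 ≤ (if y = d s then 1 else 0) + p (s, y) := by
    intro y
    have h1 := abs_le.1 (abs_actWeight_le d hp0 hp1 (s, y))
    have h0 := hp0 (s, y)
    simp only [actWeight] at h1 ⊢
    split_ifs at h1 ⊢ <;> nlinarith [h1.1, h1.2]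
  refine (Finset.sum_le_sum fun y _ => h y).trans ?_
  rw [Finset.sum_add_distrib, hp1]
  simp; norm_num

theorem sum_actWeight_mul (d : S → Y) (q : S × Y → ℝ) (s : S) :
    ∑ y, actWeight d p (s, y) * q (s, y) = q (s, d s) - ∑ y, p (s, y) * q (s, y) := by
  classical
  simp [actWeight, sub_mul, Finset.sum_sub_distrib]

variable {ν : Measure S} [IsProbabilityMeasure ν] {κ : Kernel (S × Y) ℝ} [IsMarkovKernel κ]
  [Nonempty Y]

theorem lintegral_exp_fst_compProd (ρ : Measure (S × Y)) [IsProbabilityMeasure ρ]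
    {g : S × Y → ℝ} (hg : Measurable g) :
    ∫⁻ ω, ENNReal.ofReal (Real.exp (g ω.1)) ∂(ρ ⊗ₘ κ)
      = ∫⁻ z, ENNReal.ofReal (Real.exp (g z)) ∂ρ := by
  conv_rhs => rw [← Measure.fst_compProd ρ κ, Measure.fst]
  rw [lintegral_map (by fun_prop) measurable_fst]

/-- Greediness of d for g bounds the loss by the errors |g - q| at the two actions d'(s) and d(s).
Each is absorbed by AM-GM into the sum of squared errors over all actions, whose mean is k times the
error under uniform actions. Only this square is controlled. -/
theorem integral_greedy_gap_le {B ε k l : ℝ} {n : ℕ} {q g : S × Y → ℝ} {d d' : S → Y}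
    (hk : k = Fintype.card Y)
    (hε : 0 < ε) (hn : 0 < n) (hN : 2 ^ 20 * k * B ^ 2 * l ≤ ε ^ 2 * n)
    (hq : Measurable q) (hg : Measurable g) (hqB : ∀ z, q z ∈ Set.Icc 0 B)
    (hgB : ∀ z, g z ∈ Set.Icc 0 B) (hd : Measurable d) (hd' : Measurable d')
    (hgreedy : ∀ s y, g (s, y) ≤ g (s, d s))
    (hw : n * ∫ z, (g z - q z) ^ 2 ∂(ν.prod (uniformOn (Set.univ : Set Y))) ≤ 6 * B ^ 2 * l) :
    ∫ s, (q (s, d' s) - q (s, d s)) ∂ν ≤ ε / 16 := by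
  have hn' : (0 : ℝ) < n := Nat.cast_pos.2 hn
  have hk0 : 0 < k := by rw [hk]; exact_mod_cast Fintype.card_pos
  have hgq : ∀ z, |g z - q z| ≤ B := fun z => by
    have h1 := hgB z; have h2 := hqB z
    rw [abs_le]; constructor <;> linarith [h1.1, h1.2, h2.1, h2.2]
  have hwb : ∀ z, |(g z - q z) ^ 2| ≤ B ^ 2 := fun z => by
    rw [abs_pow]; exact pow_le_pow_left₀ (abs_nonneg _) (hgq z) 2
  rw [integral_prod_uniformOn ν (by fun_prop) hwb, ← hk] at hw
  set T := ∫ s, ∑ y, (g (s, y) - q (s, y)) ^ 2 ∂ν with hT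
  have hTint : Integrable (fun s => ∑ y, (g (s, y) - q (s, y)) ^ 2) ν := by
    refine integrable_finsetSum _ fun y _ => Integrable.of_bound
      (Measurable.aestronglyMeasurable (by fun_prop)) (B ^ 2)
      (Filter.Eventually.of_forall fun s => hwb (s, y))
  have hpt : ∀ s, q (s, d' s) - q (s, d s)
      ≤ 32 / ε * (∑ y, (g (s, y) - q (s, y)) ^ 2) + ε / 32 := by
    intro s
    have key : ∀ y c, |c| = 1 → c * (q (s, y) - g (s, y)) ≤
        16 / ε * (∑ y, (g (s, y) - q (s, y)) ^ 2) + ε / 64 := by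
      intro y c hc
      have h1 : (g (s, y) - q (s, y)) ^ 2 ≤ ∑ y, (g (s, y) - q (s, y)) ^ 2 :=
        Finset.single_le_sum (f := fun y => (g (s, y) - q (s, y)) ^ 2)
          (fun y _ => sq_nonneg _) (Finset.mem_univ y)
      have h2 : 16 / ε * (g (s, y) - q (s, y)) ^ 2 ≤
          16 / ε * ∑ y, (g (s, y) - q (s, y)) ^ 2 :=
        mul_le_mul_of_nonneg_left h1 (by positivity)
      have hc2 : c ^ 2 = 1 := by rw [← sq_abs, hc, one_pow]
      have h3 : 16 / ε * (g (s, y) - q (s, y)) ^ 2 + ε / 64 - c * (q (s, y) - g (s, y))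
          = 16 / ε * (c * (g (s, y) - q (s, y)) + ε / 32) ^ 2 := by
        have e : (c * (g (s, y) - q (s, y)) + ε / 32) ^ 2
          = c ^ 2 * (g (s, y) - q (s, y)) ^ 2 + c * (g (s, y) - q (s, y)) * (ε / 16)
            + ε ^ 2 / 1024 := by ring
        rw [e, hc2]; field_simp; ring
      have : 0 ≤ 16 / ε * (c * (g (s, y) - q (s, y)) + ε / 32) ^ 2 := by positivity
      linarith
    have h1 := key (d' s) 1 (by simp)
    have h2 := key (d s) (-1) (by simp)
    have h3 := hgreedy s (d' s)
    have : 32 / ε * (∑ y, (g (s, y) - q (s, y)) ^ 2)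
      = 2 * (16 / ε * (∑ y, (g (s, y) - q (s, y)) ^ 2)) := by ring
    linarith
  have hint : Integrable (fun s => q (s, d' s) - q (s, d s)) ν := by
    refine Integrable.of_bound (Measurable.aestronglyMeasurable (by fun_prop)) B
      (Filter.Eventually.of_forall fun s => ?_)
    have h1 := hqB (s, d' s); have h2 := hqB (s, d s)
    rw [Real.norm_eq_abs, abs_le]; constructor <;> linarith [h1.1, h1.2, h2.1, h2.2]
  calc ∫ s, (q (s, d' s) - q (s, d s)) ∂ν
      ≤ ∫ s, (32 / ε * (∑ y, (g (s, y) - q (s, y)) ^ 2) + ε / 32) ∂ν :=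
        integral_mono hint ((hTint.const_mul _).add (integrable_const _)) hpt
    _ = 32 / ε * T + ε / 32 := by
        rw [integral_add (hTint.const_mul _) (integrable_const _), integral_const_mul]; simp [hT]
    _ ≤ ε / 16 := by
        have h1 : T ≤ 6 * (k * B ^ 2 * l) / n := by
          rw [le_div_iff₀ hn']
          have := mul_le_mul_of_nonneg_left hw hk0.le
          have e : k * (n * (k⁻¹ * T)) = T * n := by field_simp
          linarith
        have h2 : 6 * (k * B ^ 2 * l) / n ≤ ε ^ 2 / 1024 := by
          rw [div_le_iff₀ hn']
          have : 0 ≤ ε ^ 2 * n := by positivity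
          linarith
        have h3 : 32 / ε * T ≤ 32 / ε * (ε ^ 2 / 1024) :=
          mul_le_mul_of_nonneg_left (h1.trans h2) (by positivity)
        have h4 : 32 / ε * (ε ^ 2 / 1024) = ε / 32 := by field_simp; norm_num
        linarith

theorem exists_regression_event {ι : Type*} (F : Finset ι) {f : ι → S × Y → ℝ} {d : ι → S → Y}
    {B ε δ : ℝ} {n : ℕ} {q : S × Y → ℝ}
    (hB : 0 < B) (hε : 0 < ε) (hεB : ε ≤ B) (hn : 0 < n) (hδ : 0 < δ)
    (hF : F.Nonempty)
    (hN : 2 ^ 20 * Fintype.card Y * B ^ 2 * Real.log (5 * F.card / δ) ≤ ε ^ 2 * n)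
    (hκ : ∀ z, ∀ᵐ r ∂κ z, r ∈ Set.Icc 0 B) (hqκ : ∀ z, q z = ∫ r, r ∂κ z) (hq : Measurable q)
    (hqB : ∀ z, q z ∈ Set.Icc 0 B)
    (hp : Measurable p) (hp0 : ∀ z, 0 ≤ p z) (hp1 : ∀ s, ∑ y, p (s, y) = 1)
    (hf : ∀ i ∈ F, Measurable (f i)) (hd : ∀ i, Measurable (d i))
    (hgreedy : ∀ i ∈ F, ∀ s y, f i (s, y) ≤ f i (s, d i s)) :
    ∃ E : Set (Fin n → (S × Y) × ℝ), MeasurableSet E ∧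
      1 - δ ≤ (Measure.pi fun _ : Fin n =>
        (ν.prod (uniformOn (Set.univ : Set Y))) ⊗ₘ κ).real E ∧
      ∀ D ∈ E, ∀ i ∈ F,
        ∑ j, (f i (D j).1 - (D j).2) ^ 2 ≤ ∑ j, (q (D j).1 - (D j).2) ^ 2 →
        |(1 / (n : ℝ)) * ∑ j, (Fintype.card Y : ℝ) * actWeight (d i) p (D j).1 * f i (D j).1
          - ∫ s, (q (s, d i s) - ∑ y, p (s, y) * q (s, y)) ∂ν| ≤ ε / 16 ∧
        ∀ d' : S → Y, Measurable d' → ∫ s, (q (s, d' s) - q (s, d i s)) ∂ν ≤ ε / 16 := by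
  have : IsProbabilityMeasure (uniformOn (Set.univ : Set Y)) :=
    isProbabilityMeasure_uniformOn Set.finite_univ Set.univ_nonempty
  set ρ := ν.prod (uniformOn (Set.univ : Set Y)) with hρ
  set k : ℝ := (Fintype.card Y : ℝ) with hk
  have hk1 : 1 ≤ k := by rw [hk]; exact_mod_cast Fintype.card_pos
  have hk0 : 0 < k := by linarith
  set l := Real.log (5 * F.card / δ) with hl
  set W : ι → S × Y → ℝ := fun i => actWeight (d i) p with hW
  set w : ι → S × Y → ℝ := fun i z => (clip B (f i) z - q z) ^ 2 with hw
  set a : ι → ℝ := fun i => ∫ s, (q (s, d i s) - ∑ y, p (s, y) * q (s, y)) ∂ν with ha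
  set t := ε / (128 * k * B ^ 2) with ht
  have ht0 : 0 < t := by positivity
  -- Five exponents per function: the rollout noise; the lower tail of the truncated squared error,
  -- which transfers the in-sample error to the population; the size of the weights; and the two
  -- Bernstein tails of the estimate with the true q. Truncation makes the second exponent bounded.
  let φ : ι × Fin 5 → (S × Y) × ℝ → ℝ := fun j => ![
    fun ω => (2 * (ω.2 - q ω.1) * (f j.1 ω.1 - q ω.1) - (f j.1 ω.1 - q ω.1) ^ 2 / 2) / B ^ 2,
    fun ω => -(w j.1 ω.1 / B ^ 2) - -(∫ z, w j.1 z ∂ρ) / (2 * B ^ 2),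
    fun ω => W j.1 ω.1 ^ 2 - 4 / k,
    fun ω => t * (k * W j.1 ω.1 * q ω.1 - a j.1) - 2 * t ^ 2 * (k * B ^ 2),
    fun ω => -t * (k * W j.1 ω.1 * q ω.1 - a j.1) - 2 * t ^ 2 * (k * B ^ 2)] j.2
  have hWm : ∀ i, Measurable (W i) := fun i => measurable_actWeight (hd i) hp
  have hwm : ∀ i ∈ F, Measurable (w i) := fun i hi =>
    ((measurable_clip (hf i hi)).sub hq).pow_const 2
  have hWb : ∀ i z, |W i z| ≤ 1 := fun i => abs_actWeight_le (d i) hp0 hp1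
  have hwb : ∀ i z, w i z ∈ Set.Icc 0 (B ^ 2) := fun i z => by
    have h1 := clip_mem hB.le (f i) z
    have h2 := hqB z
    refine ⟨sq_nonneg _, sq_le_sq' ?_ ?_⟩ <;> linarith [h1.1, h1.2, h2.1, h2.2]
  have hφm : ∀ j ∈ F ×ˢ (Finset.univ : Finset (Fin 5)), Measurable (φ j) := by
    rintro ⟨i, c⟩ hj
    have hi : i ∈ F := (Finset.mem_product.1 hj).1
    have := hf i hi
    have := hWm i
    have := hwm i hi
    fin_cases c <;> simp [φ] <;> fun_prop
  have hψ1 : ∀ i, ∫ z, k * W i z * q z ∂ρ = a i := by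
    intro i
    have := hWm i
    rw [hρ, integral_prod_uniformOn ν (g := fun z => k * W i z * q z) (by fun_prop) (c := k * B)]
    · rw [← hk, ← integral_const_mul]
      refine integral_congr_ae (Filter.Eventually.of_forall fun s => ?_)
      simp only [mul_assoc]
      rw [← Finset.mul_sum, inv_mul_cancel_left₀ hk0.ne', hW, sum_actWeight_mul]
    · intro z
      rw [abs_mul, abs_mul, abs_of_pos hk0, abs_of_nonneg (hqB z).1]
      calc k * |W i z| * q z ≤ k * 1 * B :=
            mul_le_mul (mul_le_mul_of_nonneg_left (hWb i z) hk0.le) (hqB z).2 (hqB z).1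
              (by positivity)
        _ = k * B := by ring
  have hWsq : ∀ i, ∫ z, W i z ^ 2 ∂ρ ≤ 2 / k := by
    intro i
    rw [hρ, integral_prod_uniformOn ν ((hWm i).pow_const 2) (c := 1), ← hk, div_eq_inv_mul]
    · refine mul_le_mul_of_nonneg_left ?_ (by positivity)
      calc ∫ s, ∑ y, W i (s, y) ^ 2 ∂ν ≤ ∫ _, (2 : ℝ) ∂ν :=
            integral_mono_of_nonneg
              (Filter.Eventually.of_forall fun s => Finset.sum_nonneg fun y _ => sq_nonneg _)
              (integrable_const _)
              (Filter.Eventually.of_forall fun s => sum_actWeight_sq_le (d i) hp0 hp1 s)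
        _ = 2 := by simp
    · intro z
      rw [abs_pow]
      exact pow_le_one₀ (abs_nonneg _) (hWb i z)
  have hWint : ∀ i, Integrable (fun z => W i z ^ 2) ρ := fun i =>
    Integrable.of_bound ((hWm i).pow_const 2).aestronglyMeasurable 1
      (Filter.Eventually.of_forall fun z => by
        rw [Real.norm_eq_abs, abs_pow]; exact pow_le_one₀ (abs_nonneg _) (hWb i z))
  have hψb : ∀ i z, |k * W i z * q z| ≤ k * B := fun i z => by
    rw [abs_mul, abs_mul, abs_of_pos hk0, abs_of_nonneg (hqB z).1]
    exact mul_le_mul (by nlinarith [hWb i z]) (hqB z).2 (hqB z).1 hk0.le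
  have hψint : ∀ i, Integrable (fun z => k * W i z * q z) ρ := fun i =>
    Integrable.of_bound (((hWm i).const_mul k).mul hq).aestronglyMeasurable (k * B)
      (Filter.Eventually.of_forall (hψb i))
  have hψ2int : ∀ i, Integrable (fun z => (k * W i z * q z) ^ 2) ρ := fun i =>
    Integrable.of_bound ((((hWm i).const_mul k).mul hq).pow_const 2).aestronglyMeasurable
      ((k * B) ^ 2) (Filter.Eventually.of_forall fun z => by
        rw [Real.norm_eq_abs, abs_pow]
        exact pow_le_pow_left₀ (abs_nonneg _) (hψb i z) 2)
  have hψ2 : ∀ i, ∫ z, (k * W i z * q z) ^ 2 ∂ρ ≤ 2 * (k * B ^ 2) := by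
    intro i
    calc ∫ z, (k * W i z * q z) ^ 2 ∂ρ ≤ ∫ z, (k * B) ^ 2 * W i z ^ 2 ∂ρ := by
          refine integral_mono (hψ2int i) ((hWint i).const_mul _) fun z => ?_
          have : q z ^ 2 ≤ B ^ 2 := pow_le_pow_left₀ (hqB z).1 (hqB z).2 2
          have h2 : 0 ≤ (k * W i z) ^ 2 := sq_nonneg _
          simp only
          nlinarith
      _ ≤ (k * B) ^ 2 * (2 / k) := by
          rw [integral_const_mul]
          exact mul_le_mul_of_nonneg_left (hWsq i) (sq_nonneg _)
      _ = 2 * (k * B ^ 2) := by field_simp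
  -- With exp x ≤ 1 + x + x² the penalty is t² times the second moment, at most 2kB². The condition
  -- |x| ≤ 1 holds since t·kB = ε/(128B).
  have hbern : ∀ i, ∀ c : ℝ, |c| = t →
      ∫⁻ ω, ENNReal.ofReal (Real.exp (c * (k * W i ω.1 * q ω.1 - a i)
        - 2 * t ^ 2 * (k * B ^ 2))) ∂(ρ ⊗ₘ κ) ≤ 1 := by
    intro i c hc
    have := hWm i
    rw [lintegral_exp_fst_compProd ρ (g := fun z => c * (k * W i z * q z - a i)
        - 2 * t ^ 2 * (k * B ^ 2)) (by fun_prop)]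
    have hV : Integrable (fun z => c * (k * W i z * q z) + (c * (k * W i z * q z)) ^ 2) ρ := by
      simp only [mul_pow c]
      exact ((hψint i).const_mul c).add ((hψ2int i).const_mul (c ^ 2))
    refine le_trans (lintegral_mono fun z => ENNReal.ofReal_le_ofReal (Real.exp_le_exp.2 ?_))
      (lintegral_exp_sub_integral_le_one hV (U := fun z => c * (k * W i z * q z))
        fun z => exp_le_one_add_add_sq ?_)
    · simp only [mul_pow c]
      rw [integral_add ((hψint i).const_mul c) ((hψ2int i).const_mul (c ^ 2)),
        integral_const_mul, integral_const_mul, hψ1]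
      have h2 : c ^ 2 = t ^ 2 := by rw [← sq_abs, hc]
      rw [h2]
      have := mul_le_mul_of_nonneg_left (hψ2 i) (sq_nonneg t)
      linarith
    · rw [abs_mul, hc]
      calc t * |k * W i z * q z| ≤ t * (k * B) :=
            mul_le_mul_of_nonneg_left (hψb i z) ht0.le
        _ = ε / (128 * B) := by rw [ht]; field_simp
        _ ≤ 1 := by rw [div_le_one (by positivity)]; linarith
  have hφ1 : ∀ j ∈ F ×ˢ (Finset.univ : Finset (Fin 5)),
      ∫⁻ ω, ENNReal.ofReal (Real.exp (φ j ω)) ∂(ρ ⊗ₘ κ) ≤ 1 := by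
    rintro ⟨i, c⟩ hj
    have hi : i ∈ F := (Finset.mem_product.1 hj).1
    have hm := hφm _ hj
    have := hf i hi
    have := hWm i
    have := hwm i hi
    fin_cases c
    · rw [Measure.lintegral_compProd (by fun_prop)]
      calc _ ≤ ∫⁻ _, 1 ∂ρ := lintegral_mono fun z => by
            simp only [φ, Fin.zero_eta, Matrix.cons_val_zero, hqκ z]
            exact lintegral_exp_noise_le_one hB (hκ z) _
        _ = 1 := by simp
    · simp only [φ, Fin.mk_one, Matrix.cons_val_one, Matrix.cons_val_zero]
      rw [lintegral_exp_fst_compProd ρ (g := fun z => -(w i z / B ^ 2)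
        - -(∫ z, w i z ∂ρ) / (2 * B ^ 2)) (by fun_prop)]
      have hwint : Integrable (w i) ρ := Integrable.of_bound this.aestronglyMeasurable (B ^ 2)
        (Filter.Eventually.of_forall fun z => by
          rw [Real.norm_eq_abs, abs_of_nonneg (hwb i z).1]; exact (hwb i z).2)
      have h1 := lintegral_exp_sub_integral_le_one (P := ρ)
        (U := fun z => -(w i z / B ^ 2)) (V := fun z => -(w i z) / (2 * B ^ 2))
        (hwint.neg.div_const _) fun z => by
          have := exp_neg_le_one_sub_half (x := w i z / B ^ 2)
            (div_nonneg (hwb i z).1 (by positivity))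
            ((div_le_one (by positivity)).2 (hwb i z).2)
          have e : w i z / B ^ 2 / 2 = w i z / (2 * B ^ 2) := by field_simp
          rw [neg_div, ← e]; linarith
      rwa [integral_div, integral_neg] at h1
    · simp only [φ, Fin.reduceFinMk, Matrix.cons_val]
      rw [lintegral_exp_fst_compProd ρ (g := fun z => W i z ^ 2 - 4 / k) (by fun_prop)]
      refine le_trans (lintegral_mono fun z => ENNReal.ofReal_le_ofReal (Real.exp_le_exp.2 ?_))
        (lintegral_exp_sub_integral_le_one ((hWint i).const_mul 2) (U := fun z => W i z ^ 2)
          fun z => exp_le_one_add_two_mul (sq_nonneg _) ?_)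
      · rw [integral_const_mul]
        have := hWsq i
        have e : 4 / k = 2 * (2 / k) := by ring
        linarith
      · rw [← sq_abs]
        exact pow_le_one₀ (abs_nonneg _) (hWb i z)
    · simpa [φ] using hbern i t (abs_of_pos ht0)
    · simpa [φ] using hbern i (-t) (by rw [abs_neg, abs_of_pos ht0])
  have hcard : 0 < (F.card : ℝ) := by exact_mod_cast hF.card_pos
  -- The level l is chosen so that the union over 5|F| events costs exactly δ.
  obtain ⟨E, hE, hEP, hED⟩ := exists_event_sum_lt (P := ρ ⊗ₘ κ) _ hφm hφ1 n (l := l) (δ := δ) (by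
    rw [hl, Real.exp_neg, Real.exp_log (by positivity), Finset.card_product]
    simp only [Finset.card_univ, Fintype.card_fin, Nat.cast_mul, Nat.cast_ofNat]
    apply le_of_eq
    field_simp)
  refine ⟨E, hE, hEP, fun D hD i hi hls => ?_⟩
  have hb : ∀ c, ∑ j, φ (i, c) (D j) < l := fun c => hED D hD (i, c) (by simp [hi])
  have h1 := hb 0
  have h2 := hb 1
  have h3 := hb 2
  have h4 := hb 3
  have h5 := hb 4
  simp only [φ, Matrix.cons_val, Matrix.cons_val_zero, Matrix.cons_val_one] at h1 h2 h3 h4 h5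
  obtain ⟨hA, hadv⟩ := abs_advantage_error_le (z := fun j => (D j).1) (r := fun j => (D j).2)
    hk1 hB hε hεB hn hN hls h1 h3 h4 h5
  refine ⟨hadv, fun d' hd' => ?_⟩
  -- Truncation is monotone, so a greedy action for f stays greedy for its truncation. It is also
  -- 1-Lipschitz and fixes q, so it does not increase the in-sample error. The constant 6 is 2·2 +
  -- 2, from `hA` and `h2`.
  refine integral_greedy_gap_le (g := clip B (f i)) hk hε hn hN hq (measurable_clip (hf i hi))
    hqB (clip_mem hB.le (f i)) (hd i) hd'
    (fun s y => max_le_max le_rfl (min_le_min le_rfl (hgreedy i hi s y))) ?_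
  have h6 : ∑ j, w i (D j).1 ≤ 2 * B ^ 2 * l := by
    refine (Finset.sum_le_sum fun j _ => ?_).trans hA
    exact sq_le_sq.2 (abs_clip_sub_le (f i) (hqB _))
  rw [Finset.sum_sub_distrib, Finset.sum_neg_distrib, ← Finset.sum_div] at h2
  simp only [Finset.sum_const, Finset.card_univ, Fintype.card_fin, nsmul_eq_mul] at h2
  have h7 := mul_lt_mul_of_pos_left h2 (by positivity : 0 < 2 * B ^ 2)
  have e : 2 * B ^ 2 * (-((∑ j, w i (D j).1) / B ^ 2)
      - n * (-(∫ z, w i z ∂ρ) / (2 * B ^ 2)))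
      = n * ∫ z, w i z ∂ρ - 2 * ∑ j, w i (D j).1 := by
    field_simp; ring
  change (n : ℝ) * ∫ z, w i z ∂ρ ≤ _
  linarith

end Regression

/-! ### Integration against kernels, and action averages. -/

theorem integral_bind_kernel {S T : Type*} [MeasurableSpace S] [MeasurableSpace T]
    (μ : Measure S) [SFinite μ] (κ : Kernel S T) [IsSFiniteKernel κ] {g : T → ℝ}
    (hg : Integrable g (μ.bind κ)) : ∫ t, g t ∂(μ.bind κ) = ∫ s, ∫ t, g t ∂(κ s) ∂μ := by
  have h : μ.bind κ = (κ ∘ₖ Kernel.const Unit μ) () := Measure.comp_eq_comp_const_apply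
  rw [h] at hg ⊢
  rw [Kernel.integral_comp hg, Kernel.const_apply]

theorem integrable_of_abs_le {S : Type*} [MeasurableSpace S] {μ : Measure S} [IsFiniteMeasure μ]
    {g : S → ℝ} (hg : Measurable g) {c : ℝ} (hc : ∀ s, |g s| ≤ c) : Integrable g μ :=
  Integrable.of_bound hg.aestronglyMeasurable c (Filter.Eventually.of_forall hc)

theorem integral_mem_Icc_of_ae {μ : Measure ℝ} [IsProbabilityMeasure μ] {c : ℝ}
    (h : ∀ᵐ z ∂μ, z ∈ Set.Icc 0 c) : Integrable (fun z => z) μ ∧ ∫ z, z ∂μ ∈ Set.Icc 0 c := by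
  have hint : Integrable (fun z : ℝ => z) μ := by
    refine Integrable.of_bound measurable_id.aestronglyMeasurable c ?_
    filter_upwards [h] with z hz
    simpa [abs_of_nonneg hz.1] using hz.2
  refine ⟨hint, integral_nonneg_of_ae (h.mono fun z hz => hz.1), ?_⟩
  calc ∫ z, z ∂μ ≤ ∫ _, c ∂μ := integral_mono_ae hint (integrable_const c) (h.mono fun z hz => hz.2)
    _ = c := by simp

section Kernels

variable {X Y : Type*} [MeasurableSpace X] [Fintype Y] [MeasurableSpace Y] {H : ℕ}

theorem Policy.sum_ofReal_prob (π : Policy X Y H) (h : Fin H) (x : X) :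
    ∑ y, ENNReal.ofReal (π.prob h x y) = 1 := by
  rw [← ENNReal.ofReal_sum_of_nonneg fun y _ => π.prob_nonneg h x y, π.sum_prob,
    ENNReal.ofReal_one]

theorem Policy.kernel_apply (π : Policy X Y H) (h : Fin H) (x : X) :
    π.kernel h x = ∑ y, ENNReal.ofReal (π.prob h x y) • Measure.dirac y := rfl

instance Policy.isMarkovKernel_kernel (π : Policy X Y H) (h : Fin H) :
    IsMarkovKernel (π.kernel h) := ⟨fun x => ⟨by
  simp [Policy.kernel_apply, π.sum_ofReal_prob]⟩⟩

theorem Policy.comp_id_prod_kernel_apply {T : Type*} [MeasurableSpace T] (π : Policy X Y H)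
    (h : Fin H) (κ : Kernel (X × Y) T) (x : X) :
    (κ ∘ₖ (Kernel.id ×ₖ π.kernel h)) x
      = ∑ y, ENNReal.ofReal (π.prob h x y) • κ (x, y) := by
  ext s hs
  have hm : Measurable fun z : X × Y => κ z s := κ.measurable_coe hs
  rw [Kernel.comp_apply' _ _ _ hs, Kernel.lintegral_id_prod hm, Policy.kernel_apply,
    lintegral_finsetSum_measure]
  simp only [lintegral_smul_measure, Measure.coe_finsetSum, Finset.sum_apply, Measure.smul_apply,
    smul_eq_mul]
  refine Finset.sum_congr rfl fun y _ => ?_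
  rw [lintegral_dirac' (f := fun a => κ (x, a) s) _ (hm.comp measurable_prodMk_left)]

theorem Policy.integral_comp_id_prod_kernel {T : Type*} [MeasurableSpace T] (π : Policy X Y H)
    (h : Fin H) (κ : Kernel (X × Y) T) (x : X) {g : T → ℝ}
    (hg : ∀ y, Integrable g (κ (x, y))) :
    ∫ t, g t ∂((κ ∘ₖ (Kernel.id ×ₖ π.kernel h)) x)
      = ∑ y, π.prob h x y * ∫ t, g t ∂(κ (x, y)) := by
  rw [π.comp_id_prod_kernel_apply, integral_finsetSum_measure fun y _ =>
    (hg y).smul_measure ENNReal.ofReal_ne_top]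
  simp [integral_smul_measure, ENNReal.toReal_ofReal, π.prob_nonneg]

theorem Policy.abs_sum_prob_mul_le (π : Policy X Y H) (h : Fin H) (x : X) {g : Y → ℝ} {c : ℝ}
    (hg : ∀ y, |g y| ≤ c) : |∑ y, π.prob h x y * g y| ≤ c := by
  calc |∑ y, π.prob h x y * g y| ≤ ∑ y, π.prob h x y * c := by
        refine (Finset.abs_sum_le_sum_abs _ _).trans (Finset.sum_le_sum fun y _ => ?_)
        rw [abs_mul, abs_of_nonneg (π.prob_nonneg h x y)]
        exact mul_le_mul_of_nonneg_left (hg y) (π.prob_nonneg h x y)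
    _ = c := by rw [← Finset.sum_mul, π.sum_prob, one_mul]

end Kernels

/-! ### Return laws, value functions and state laws. -/

namespace MDP

variable {X Y : Type*} [MeasurableSpace X] [Fintype Y] [MeasurableSpace Y] {H : ℕ}
  (M : MDP X Y H) (π : Policy X Y H)

instance : IsProbabilityMeasure M.init := M.isProbabilityMeasure_init

instance (h : Fin H) : IsMarkovKernel (M.trans h) := M.isMarkovKernel_trans h

theorem measurable_reward_add (h : Fin H) :
    Measurable fun z : (X × Y) × ℝ => M.reward h z.1.1 z.1.2 + z.2 :=
  ((M.measurable_reward h).comp measurable_fst).add measurable_snd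

theorem actReturn_apply (h : Fin H) (κ : Kernel X ℝ) [IsSFiniteKernel κ] (x : X) (y : Y) :
    M.actReturn h κ (x, y)
      = ((κ ∘ₖ M.trans h) (x, y)).map (fun r => M.reward h x y + r) := by
  rw [actReturn, Kernel.map_apply _ (M.measurable_reward_add h), Kernel.prod_apply,
    Kernel.id_apply, Measure.dirac_prod,
    Measure.map_map (M.measurable_reward_add h) measurable_prodMk_left]
  rfl

instance (h : Fin H) (κ : Kernel X ℝ) [IsMarkovKernel κ] : IsMarkovKernel (M.actReturn h κ) :=
  Kernel.IsMarkovKernel.map _ (M.measurable_reward_add h)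

theorem returnLaw_of_lt {h : ℕ} (hh : h < H) : M.returnLaw π h
    = M.actReturn ⟨h, hh⟩ (M.returnLaw π (h + 1)) ∘ₖ (Kernel.id ×ₖ π.kernel ⟨h, hh⟩) := by
  rw [returnLaw, dif_pos hh]

theorem returnLaw_of_le {h : ℕ} (hh : H ≤ h) :
    M.returnLaw π h = Kernel.const X (Measure.dirac 0) := by
  rw [returnLaw, dif_neg (not_lt.2 hh)]

instance isMarkovKernel_returnLaw (h : ℕ) : IsMarkovKernel (M.returnLaw π h) := by
  by_cases hh : h < H
  · have := isMarkovKernel_returnLaw (h + 1)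
    rw [M.returnLaw_of_lt π hh]
    infer_instance
  · rw [M.returnLaw_of_le π (not_lt.1 hh)]
    infer_instance
termination_by H - h

instance (h : Fin H) : IsMarkovKernel (M.qRollout π h) := by
  rw [qRollout]; infer_instance

instance : IsMarkovKernel (M.rolloutKernel π) :=
  ⟨fun z => inferInstanceAs (IsProbabilityMeasure (M.qRollout π z.1.1 (z.1.2, z.2)))⟩

variable {M} {R : ℝ}

theorem actReturn_mem (hR : ∀ h x y, M.reward h x y ∈ Set.Icc 0 R) (h : Fin H)
    {κ : Kernel X ℝ} [IsMarkovKernel κ] {c : ℝ} (hκ : ∀ x, ∀ᵐ z ∂κ x, z ∈ Set.Icc 0 c)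
    (w : X × Y) : ∀ᵐ z ∂M.actReturn h κ w, z ∈ Set.Icc 0 (R + c) := by
  obtain ⟨x, y⟩ := w
  rw [actReturn_apply, ae_map_iff (p := fun z => z ∈ Set.Icc 0 (R + c)) (by fun_prop)
    measurableSet_Icc]
  have : ∀ᵐ z ∂(κ ∘ₖ M.trans h) (x, y), z ∈ Set.Icc 0 c :=
    Kernel.ae_comp_of_ae_ae measurableSet_Icc (Filter.Eventually.of_forall hκ)
  filter_upwards [this] with z hz
  have := hR h x y
  exact ⟨by linarith [this.1, hz.1], by linarith [this.2, hz.2]⟩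

theorem returnLaw_mem (hR : ∀ h x y, M.reward h x y ∈ Set.Icc 0 R) (h : ℕ) (x : X) :
    ∀ᵐ z ∂M.returnLaw π h x, z ∈ Set.Icc 0 (((H - h : ℕ) : ℝ) * R) := by
  by_cases hh : h < H
  · rw [M.returnLaw_of_lt π hh]
    refine Kernel.ae_comp_of_ae_ae measurableSet_Icc (Filter.Eventually.of_forall fun w => ?_)
    have := actReturn_mem hR ⟨h, hh⟩ (returnLaw_mem hR (h + 1)) w
    have e : R + ((H - (h + 1) : ℕ) : ℝ) * R = ((H - h : ℕ) : ℝ) * R := by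
      rw [show H - h = (H - (h + 1)) + 1 by omega]; push_cast; ring
    rwa [e] at this
  · rw [M.returnLaw_of_le π (not_lt.1 hh), Kernel.const_apply]
    rw [ae_dirac_iff (p := fun z => z ∈ Set.Icc 0 (((H - h : ℕ) : ℝ) * R)) measurableSet_Icc]
    simp [Nat.sub_eq_zero_of_le (not_lt.1 hh)]
termination_by H - h

theorem V_mem (hR : ∀ h x y, M.reward h x y ∈ Set.Icc 0 R) (h : ℕ) (x : X) :
    M.V π h x ∈ Set.Icc 0 (((H - h : ℕ) : ℝ) * R) :=
  (integral_mem_Icc_of_ae (returnLaw_mem π hR h x)).2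

theorem V_of_le {h : ℕ} (hh : H ≤ h) (x : X) : M.V π h x = 0 := by
  rw [V, M.returnLaw_of_le π hh, Kernel.const_apply, integral_dirac]

theorem qRollout_mem (hR : ∀ h x y, M.reward h x y ∈ Set.Icc 0 R) (h : Fin H) (w : X × Y) :
    ∀ᵐ z ∂M.qRollout π h w, z ∈ Set.Icc 0 (((H - h : ℕ) : ℝ) * R) := by
  have := actReturn_mem hR h (returnLaw_mem π hR (h + 1)) w
  have e : R + ((H - (h + 1) : ℕ) : ℝ) * R = ((H - h : ℕ) : ℝ) * R := by
    rw [show H - (h : ℕ) = (H - (h + 1)) + 1 by omega]; push_cast; ring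
  rwa [e] at this

/-- A Q-rollout is an unbiased estimate of the action value. -/
theorem integral_qRollout (hR : ∀ h x y, M.reward h x y ∈ Set.Icc 0 R) (h : Fin H) (x : X)
    (y : Y) : ∫ z, z ∂(M.qRollout π h (x, y)) = M.Q π h x y := by
  have hmem : ∀ᵐ z ∂(M.returnLaw π (h + 1) ∘ₖ M.trans h) (x, y),
      z ∈ Set.Icc 0 (((H - (h + 1) : ℕ) : ℝ) * R) :=
    Kernel.ae_comp_of_ae_ae measurableSet_Icc
      (Filter.Eventually.of_forall (returnLaw_mem π hR (h + 1)))
  have hint := (integral_mem_Icc_of_ae hmem).1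
  rw [qRollout, actReturn_apply, integral_map (by fun_prop) (by fun_prop),
    integral_add (integrable_const _) hint, Kernel.integral_comp hint]
  simp [Q, V]

theorem Q_mem (hR : ∀ h x y, M.reward h x y ∈ Set.Icc 0 R) (h : Fin H) (x : X) (y : Y) :
    M.Q π h x y ∈ Set.Icc 0 (((H - h : ℕ) : ℝ) * R) := by
  rw [← integral_qRollout π hR]
  exact (integral_mem_Icc_of_ae (qRollout_mem π hR h (x, y))).2

theorem abs_A_le (hR : ∀ h x y, M.reward h x y ∈ Set.Icc 0 R) (h : Fin H) (x : X) (y : Y) :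
    |M.A π h x y| ≤ ((H - h : ℕ) : ℝ) * R := by
  have h1 := Q_mem π hR h x y
  have h2 := V_mem π hR h x
  rw [A, abs_le]
  constructor <;> linarith [h1.1, h1.2, h2.1, h2.2]

/-- The Bellman equation. -/
theorem V_eq_sum (hR : ∀ h x y, M.reward h x y ∈ Set.Icc 0 R) (h : Fin H) (x : X) :
    M.V π h x = ∑ y, π.prob h x y * M.Q π h x y := by
  rw [V, M.returnLaw_of_lt π h.2, π.integral_comp_id_prod_kernel]
  · exact Finset.sum_congr rfl fun y _ => by rw [← integral_qRollout π hR]; rfl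
  · exact fun y => (integral_mem_Icc_of_ae (qRollout_mem π hR h (x, y))).1

theorem sum_prob_mul_A (hR : ∀ h x y, M.reward h x y ∈ Set.Icc 0 R) (π' : Policy X Y H)
    (h : Fin H) (x : X) : ∑ y, π'.prob h x y * M.A π h x y
      = ∑ y, π'.prob h x y * M.Q π h x y - ∑ y, π.prob h x y * M.Q π h x y := by
  simp only [A, mul_sub, Finset.sum_sub_distrib]
  rw [← Finset.sum_mul, π'.sum_prob, one_mul, V_eq_sum π hR]

theorem J_eq_integral_V (hR : ∀ h x y, M.reward h x y ∈ Set.Icc 0 R) :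
    M.J π = ∫ x, M.V π 0 x ∂M.init := by
  rw [J, integral_bind_kernel]
  · rfl
  · refine Integrable.of_bound measurable_id.aestronglyMeasurable (((H - 0 : ℕ) : ℝ) * R) ?_
    have := Measure.ae_comp_of_ae_ae (μ := M.init) (κ := M.returnLaw π 0) measurableSet_Icc
      (Filter.Eventually.of_forall (returnLaw_mem π hR 0))
    filter_upwards [this] with z hz
    simpa [abs_of_nonneg hz.1] using hz.2

theorem stateLaw_succ {h : ℕ} (hh : h < H) : M.stateLaw π (h + 1) = (M.stateLaw π h).bind
    (M.trans ⟨h, hh⟩ ∘ₖ (Kernel.id ×ₖ π.kernel ⟨h, hh⟩)) := by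
  rw [stateLaw, dif_pos hh]

theorem isProbabilityMeasure_stateLaw {h : ℕ} (hh : h ≤ H) :
    IsProbabilityMeasure (M.stateLaw π h) := by
  induction h with
  | zero => exact M.isProbabilityMeasure_init
  | succ h ih =>
    have := ih (by omega)
    rw [stateLaw_succ π (by omega)]
    infer_instance

instance (h : Fin H) : IsProbabilityMeasure (M.stateLaw π h) :=
  isProbabilityMeasure_stateLaw π h.2.le

theorem integral_stateLaw_succ (h : Fin H) {g : X → ℝ} (hg : Measurable g) {c : ℝ}
    (hc : ∀ x, |g x| ≤ c) : ∫ x, g x ∂(M.stateLaw π (h + 1))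
      = ∫ x, ∑ y, π.prob h x y * ∫ x', g x' ∂(M.trans h (x, y)) ∂(M.stateLaw π h) := by
  have := isProbabilityMeasure_stateLaw (M := M) π (Nat.succ_le_of_lt h.2)
  have hint : Integrable g (M.stateLaw π (h + 1)) := integrable_of_abs_le hg hc
  rw [stateLaw_succ π h.2] at hint ⊢
  rw [integral_bind_kernel _ _ hint]
  exact integral_congr_ae (Filter.Eventually.of_forall fun x =>
    π.integral_comp_id_prod_kernel h _ x fun y => integrable_of_abs_le hg hc)

end MDP

/-! ### The performance difference lemma. -/

namespace MDP

variable {X Y : Type*} [MeasurableSpace X] [Fintype Y] [MeasurableSpace Y]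
  [MeasurableSingletonClass Y] {H : ℕ} {M : MDP X Y H} {R : ℝ}

theorem measurable_sum_prob_mul (π : Policy X Y H) (h : Fin H) {g : X → Y → ℝ}
    (hg : ∀ y, Measurable fun x => g x y) : Measurable fun x => ∑ y, π.prob h x y * g x y :=
  Finset.measurable_sum _ fun y _ => (π.measurable_prob h y).mul (hg y)

theorem measurable_integral_trans (M : MDP X Y H) (h : Fin H) {g : X → ℝ} (hg : Measurable g)
    (y : Y) : Measurable fun x => ∫ x', g x' ∂(M.trans h (x, y)) :=
  ((StronglyMeasurable.integral_kernel (κ := M.trans h)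
    hg.stronglyMeasurable).measurable).comp measurable_prodMk_right

theorem measurable_Q (M : MDP X Y H) (π : Policy X Y H) (h : Fin H) (y : Y) :
    Measurable fun x => M.Q π h x y := by
  have h1 : (fun x => M.Q π h x y) = fun x => M.A π h x y + M.V π h x := by
    ext x; simp [A]
  rw [h1]
  exact (M.measurable_A π h y).add (M.measurable_V π h)

theorem abs_integral_trans_le (M : MDP X Y H) (h : Fin H) {g : X → ℝ} {c : ℝ}
    (hc : ∀ x, |g x| ≤ c) (w : X × Y) : |∫ x', g x' ∂(M.trans h w)| ≤ c := by
  simpa using norm_integral_le_of_norm_le_const (μ := M.trans h w) (f := g)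
    (Filter.Eventually.of_forall hc)

/-- Averaging Q over the actions of π' and then over its state law pushes the next-step value to
time h + 1. This puts the advantage in telescoping form. -/
theorem integral_sum_prob_mul_A (hR : ∀ h x y, M.reward h x y ∈ Set.Icc 0 R)
    (π π' : Policy X Y H) (h : Fin H) :
    ∫ x, ∑ y, π'.prob h x y * M.A π h x y ∂(M.stateLaw π' h)
      = ∫ x, ∑ y, π'.prob h x y * M.reward h x y ∂(M.stateLaw π' h)
        + (∫ x, M.V π (h + 1) x ∂(M.stateLaw π' (h + 1)) - ∫ x, M.V π h x ∂(M.stateLaw π' h)) := by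
  have hV : ∀ t x, |M.V π t x| ≤ ((H - t : ℕ) : ℝ) * R := fun t x => by
    have := V_mem π hR t x
    rw [abs_of_nonneg this.1]; exact this.2
  have hrm : ∀ y, Measurable fun x => M.reward h x y := fun y =>
    (M.measurable_reward h).comp measurable_prodMk_right
  have i1 : Integrable (fun x => ∑ y, π'.prob h x y * M.reward h x y) (M.stateLaw π' h) :=
    integrable_of_abs_le (measurable_sum_prob_mul π' h hrm) (c := R) fun x =>
      π'.abs_sum_prob_mul_le h x fun y => by
        rw [abs_of_nonneg (hR h x y).1]; exact (hR h x y).2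
  have i2 : Integrable (fun x => ∑ y, π'.prob h x y * ∫ x', M.V π (h + 1) x' ∂(M.trans h (x, y)))
      (M.stateLaw π' h) :=
    integrable_of_abs_le (measurable_sum_prob_mul π' h
      (measurable_integral_trans M h (M.measurable_V π _))) fun x =>
      π'.abs_sum_prob_mul_le h x fun y => abs_integral_trans_le M h (hV _) _
  have i3 : Integrable (M.V π h) (M.stateLaw π' h) :=
    integrable_of_abs_le (M.measurable_V π h) (hV h)
  have i23 : Integrable (fun x => ∑ y, π'.prob h x y * ∫ x', M.V π (h + 1) x' ∂(M.trans h (x, y))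
      - M.V π h x) (M.stateLaw π' h) := i2.sub i3
  rw [integral_stateLaw_succ π' h (M.measurable_V π _) (hV _), ← integral_sub i2 i3,
    ← integral_add i1 i23]
  refine integral_congr_ae (Filter.Eventually.of_forall fun x => ?_)
  simp only [A, Q, mul_sub, mul_add, Finset.sum_sub_distrib, Finset.sum_add_distrib]
  rw [← Finset.sum_mul, π'.sum_prob, one_mul]
  ring

/-- The performance difference lemma. -/
theorem J_sub_J_eq_sum (hR : ∀ h x y, M.reward h x y ∈ Set.Icc 0 R) (π π' : Policy X Y H) :
    M.J π' - M.J π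
      = ∑ h : Fin H, ∫ x, ∑ y, π'.prob h x y * M.A π h x y ∂(M.stateLaw π' h) := by
  -- The comparison policy is left free: for σ = π' the advantages average to zero, which identifies
  -- J(π') with the sum of expected rewards without a separate argument. The values telescope
  -- because V vanishes at time H.
  have key : ∀ σ : Policy X Y H,
      ∑ h : Fin H, ∫ x, ∑ y, π'.prob h x y * M.A σ h x y ∂(M.stateLaw π' h)
      = ∑ h : Fin H, ∫ x, ∑ y, π'.prob h x y * M.reward h x y ∂(M.stateLaw π' h) - M.J σ := by
    intro σ
    simp_rw [integral_sum_prob_mul_A hR σ π']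
    rw [Finset.sum_add_distrib, Fin.sum_univ_eq_sum_range
      (fun h => ∫ x, M.V σ (h + 1) x ∂(M.stateLaw π' (h + 1)) - ∫ x, M.V σ h x ∂(M.stateLaw π' h)),
      Finset.sum_range_sub (fun h => ∫ x, M.V σ h x ∂(M.stateLaw π' h)), J_eq_integral_V σ hR]
    simp [V_of_le, stateLaw, sub_eq_add_neg]
  have h0 := key π'
  simp only [sum_prob_mul_A π' hR π', sub_self, integral_zero, Finset.sum_const_zero] at h0
  rw [key π]
  linarith

end MDP

/-! ### Conservative updates on a set of states. -/

section Mix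

variable {X Y : Type*} [MeasurableSpace X] [Fintype Y] [MeasurableSpace Y]
  [MeasurableSingletonClass Y] {H : ℕ} {M : MDP X Y H} {R : ℝ}
  (π π' : Policy X Y H) {S : Fin H → Set X} (hS : ∀ h, MeasurableSet (S h))
  {α : ℝ} (hα : α ∈ Set.Icc (0 : ℝ) 1)

theorem Policy.sum_mixOn_mul (h : Fin H) (x : X) (g : Y → ℝ) :
    ∑ y, (π.mixOn π' S hS α hα).prob h x y * g y = ∑ y, π.prob h x y * g y
      + (S h).indicator (fun _ => α * (∑ y, π'.prob h x y * g y - ∑ y, π.prob h x y * g y)) x := by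
  by_cases hx : x ∈ S h
  · simp only [Policy.mixOn, hx, if_true, Set.indicator_of_mem]
    rw [← Finset.sum_sub_distrib, Finset.mul_sum, ← Finset.sum_add_distrib]
    exact Finset.sum_congr rfl fun y _ => by ring
  · simp [Policy.mixOn, hx]

/-- The change of the state distribution caused by a conservative update on `S`. -/
theorem abs_integral_stateLaw_mixOn_sub_le {w : ℕ → ℝ}
    (hw : ∀ h : Fin H, (M.stateLaw π h).real (S h) ≤ w h) {h : ℕ} (hh : h ≤ H)
    {g : X → ℝ} (hg : Measurable g) {c : ℝ} (hc : ∀ x, |g x| ≤ c) :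
    |∫ x, g x ∂(M.stateLaw (π.mixOn π' S hS α hα) h) - ∫ x, g x ∂(M.stateLaw π h)|
      ≤ 2 * α * c * ∑ t ∈ Finset.range h, w t := by
  induction h generalizing g with
  | zero => simp [MDP.stateLaw]
  | succ h ih =>
    have hlt : h < H := hh
    set σ := π.mixOn π' S hS α hα with hσ
    have hprob := fun σ : Policy X Y H =>
      MDP.isProbabilityMeasure_stateLaw (M := M) σ hlt.le
    let P : Policy X Y H → X → ℝ := fun σ x =>
      ∑ y, σ.prob ⟨h, hlt⟩ x y * ∫ x', g x' ∂(M.trans ⟨h, hlt⟩ (x, y))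
    have hPm : ∀ σ, Measurable (P σ) := fun σ =>
      MDP.measurable_sum_prob_mul σ _ (MDP.measurable_integral_trans M _ hg)
    have hPc : ∀ σ x, |P σ x| ≤ c := fun σ x =>
      σ.abs_sum_prob_mul_le _ x fun y => MDP.abs_integral_trans_le M _ hc _
    have hPint : ∀ σ σ' : Policy X Y H, Integrable (P σ) (M.stateLaw σ' h) := fun σ σ' =>
      have := hprob σ'
      integrable_of_abs_le (hPm σ) (hPc σ)
    have e1 : ∀ σ : Policy X Y H, ∫ x, g x ∂(M.stateLaw σ (h + 1)) = ∫ x, P σ x ∂(M.stateLaw σ h) :=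
      fun σ => MDP.integral_stateLaw_succ σ ⟨h, hlt⟩ hg hc
    -- The induction hypothesis is applied to the one-step average under the mixture σ. The
    -- remaining one-step error is then integrated against the state law of π, whose mass on S is
    -- what `hw` controls.
    have h1 := ih hlt.le (hPm σ) (hPc σ)
    have h2 : |∫ x, P σ x ∂(M.stateLaw π h) - ∫ x, P π x ∂(M.stateLaw π h)| ≤ 2 * α * c * w h := by
      have := hprob π
      rw [← integral_sub (hPint σ π) (hPint π π)]
      have hc0 : 0 ≤ c := by
        obtain ⟨x⟩ := (M.stateLaw π h).nonempty_of_neZero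
        exact (abs_nonneg _).trans (hc x)
      have hpt : ∀ x, ‖P σ x - P π x‖ ≤ (S ⟨h, hlt⟩).indicator (fun _ => 2 * α * c) x := by
        intro x
        have : P σ x - P π x = (S ⟨h, hlt⟩).indicator (fun x => α * (P π' x - P π x)) x := by
          simp only [P, hσ]
          rw [π.sum_mixOn_mul π' hS hα]
          by_cases hx : x ∈ S ⟨h, hlt⟩ <;> simp [hx]
        rw [this]
        by_cases hx : x ∈ S ⟨h, hlt⟩
        · simp only [Set.indicator_of_mem hx, Real.norm_eq_abs]
          rw [abs_mul, abs_of_nonneg hα.1]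
          have h1 := abs_le.1 (hPc π x)
          have h2 := abs_le.1 (hPc π' x)
          have : |P π' x - P π x| ≤ 2 * c := by
            rw [abs_le]; constructor <;> linarith [h1.1, h1.2, h2.1, h2.2]
          have := mul_le_mul_of_nonneg_left this hα.1
          linarith
        · simp [hx]
      refine (norm_integral_le_of_norm_le ((integrable_const _).indicator (hS _))
        (Filter.Eventually.of_forall hpt)).trans ?_
      rw [integral_indicator (hS _), setIntegral_const, smul_eq_mul, mul_comm]
      exact mul_le_mul_of_nonneg_left (hw ⟨h, hlt⟩)
        (mul_nonneg (mul_nonneg zero_le_two hα.1) hc0)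
    rw [e1, e1, Finset.sum_range_succ, mul_add]
    exact (abs_sub_le _ (∫ x, P σ x ∂(M.stateLaw π h)) _).trans (add_le_add h1 h2)

/-- The gain of a conservative update on `S`. -/
theorem le_J_mixOn_sub_J (hR : ∀ h x y, M.reward h x y ∈ Set.Icc 0 R) {w : ℕ → ℝ}
    (hw : ∀ h : Fin H, (M.stateLaw π h).real (S h) ≤ w h) :
    α * ∑ h : Fin H, ∫ x, (S h).indicator (fun x => ∑ y, π'.prob h x y * M.A π h x y) x
        ∂(M.stateLaw π h)
      - 2 * α ^ 2 * R * ∑ h : Fin H, ((H - h : ℕ) : ℝ) * ∑ t ∈ Finset.range h, w t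
      ≤ M.J (π.mixOn π' S hS α hα) - M.J π := by
  rw [MDP.J_sub_J_eq_sum hR, Finset.mul_sum, Finset.mul_sum, ← Finset.sum_sub_distrib]
  refine Finset.sum_le_sum fun h _ => ?_
  set G : X → ℝ := (S h).indicator (fun x => ∑ y, π'.prob h x y * M.A π h x y) with hG
  have hGm : Measurable G :=
    (MDP.measurable_sum_prob_mul π' h (M.measurable_A π h)).indicator (hS h)
  have hAc : ∀ x, |∑ y, π'.prob h x y * M.A π h x y| ≤ ((H - h : ℕ) : ℝ) * R := fun x =>
    π'.abs_sum_prob_mul_le h x (MDP.abs_A_le π hR h x)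
  have hGc : ∀ x, |G x| ≤ ((H - h : ℕ) : ℝ) * R := by
    intro x
    by_cases hx : x ∈ S h
    · simpa [hG, hx] using hAc x
    · simpa [hG, hx] using (abs_nonneg _).trans (hAc x)
  have e : ∀ x, ∑ y, (π.mixOn π' S hS α hα).prob h x y * M.A π h x y = α * G x := by
    intro x
    have h0 : ∑ y, π.prob h x y * M.A π h x y = 0 := by rw [MDP.sum_prob_mul_A π hR, sub_self]
    rw [π.sum_mixOn_mul π' hS hα, hG]
    by_cases hx : x ∈ S h <;> simp [hx, h0]
  simp_rw [e]
  rw [integral_const_mul]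
  have h1 := (abs_le.1 (abs_integral_stateLaw_mixOn_sub_le π π' hS hα hw h.2.le hGm hGc)).1
  have h2 := mul_le_mul_of_nonneg_left h1 hα.1
  have e2 : α * -(2 * α * (((H - h : ℕ) : ℝ) * R) * ∑ t ∈ Finset.range h, w t)
    = -(2 * α ^ 2 * R * (((H - h : ℕ) : ℝ) * ∑ t ∈ Finset.range h, w t)) := by ring
  linarith

theorem sum_sub_mul_le_cube (H : ℕ) :
    ∑ h : Fin H, ((H - h : ℕ) : ℝ) * (h : ℝ) ≤ (H : ℝ) ^ 3 / 4 := by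
  have : ∀ h : Fin H, ((H - h : ℕ) : ℝ) * (h : ℝ) ≤ (H : ℝ) ^ 2 / 4 := by
    intro h
    rw [Nat.cast_sub h.2.le]
    nlinarith [sq_nonneg ((H : ℝ) - 2 * h)]
  refine (Finset.sum_le_sum fun h _ => this h).trans (le_of_eq ?_)
  simp; ring

/-- Here s is the mass accumulated before time h. Since s 0 = 0, the first summand drops out and the
weights add up to H(H - 1)/2; with it they would exceed H²/2. -/
theorem sum_sub_mul_le_of_le {H : ℕ} {s : ℕ → ℝ} {W : ℝ} (h0 : s 0 = 0) (hW : 0 ≤ W)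
    (hs : ∀ h < H, s h ≤ W) :
    ∑ h : Fin H, ((H - h : ℕ) : ℝ) * s h ≤ (H : ℝ) ^ 2 / 2 * W := by
  cases H with
  | zero => simp
  | succ m =>
    have hsum : ∑ h : Fin m, ((m - h : ℕ) : ℝ) ≤ ((m : ℝ) + 1) ^ 2 / 2 := by
      rw [Fin.sum_univ_eq_sum_range (fun h => ((m - h : ℕ) : ℝ))]
      induction m with
      | zero => simp
      | succ k ih =>
        rw [Finset.sum_range_succ']
        have := ih fun h hh => hs h (by omega)
        simp only [Nat.add_sub_add_right, Nat.sub_zero]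
        push_cast
        nlinarith
    rw [Fin.sum_univ_succ]
    simp only [Fin.val_zero, h0, mul_zero, zero_add, Fin.val_succ, Nat.add_sub_add_right]
    calc ∑ h : Fin m, ((m - h : ℕ) : ℝ) * s (h + 1) ≤ ∑ h : Fin m, ((m - h : ℕ) : ℝ) * W :=
          Finset.sum_le_sum fun h _ =>
            mul_le_mul_of_nonneg_left (hs _ (by omega)) (Nat.cast_nonneg _)
      _ ≤ _ := by
          rw [← Finset.sum_mul]
          push_cast
          exact mul_le_mul_of_nonneg_right hsum hW

end Mix

/-- The gain at a step size proportional to an accurate estimate `est` of the advantage `a`. -/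
theorem sq_le_of_step {α a aPlus est ε H R p b c G : ℝ} (hH : 1 ≤ H) (hR : 0 < R) (hp : 0 ≤ p)
    (hb : 1 ≤ b) (hε : 0 < ε) (hεa : ε ≤ aPlus) (ha : aPlus - a ≤ ε / 16)
    (hest : |est - a| ≤ ε / 16) (haR : aPlus ≤ H * R) (hcb : c ≤ b / 2)
    (hα : α = min 1 (est / (b * H ^ 2 * R)))
    (hG : α * (H * p * a) - c * α ^ 2 * R * H ^ 3 * p ≤ G) :
    α ∈ Set.Icc (0 : ℝ) 1 ∧ 49 / 128 * aPlus ^ 2 * p / (b * H * R) ≤ G := by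
  have hA : 0 < aPlus := hε.trans_le hεa
  have hK : 0 < b * H ^ 2 * R := by positivity
  set K := b * H ^ 2 * R with hKdef
  obtain ⟨he1, he2⟩ := abs_le.1 hest
  -- Two errors of ε/16 ≤ aPlus/16 separate `est` from `aPlus`. Truncating the step at 1 does not
  -- hurt the lower bound on α, because aPlus ≤ H R ≤ K.
  have hest0 : 7 / 8 * aPlus ≤ est := by linarith
  have hα0 : 7 / 8 * aPlus / K ≤ α := by
    rw [hα]
    refine le_min ?_ (div_le_div_of_nonneg_right hest0 hK.le)
    rw [div_le_one hK]
    have h1 : H * R * 1 ≤ H * R * (b * H) :=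
      mul_le_mul_of_nonneg_left (by nlinarith) (by positivity)
    have h2 : K = H * R * (b * H) := by rw [hKdef]; ring
    linarith
  have hα1 : α ≤ est / K := hα ▸ min_le_right _ _
  have hαpos : 0 ≤ α := le_trans (by positivity) hα0
  refine ⟨⟨hαpos, hα ▸ min_le_left _ _⟩, ?_⟩
  have hαK : α * K ≤ est := (le_div_iff₀ hK).1 hα1
  have h1 : c * (α * (H ^ 2 * R)) ≤ est / 2 := by
    calc c * (α * (H ^ 2 * R)) ≤ b / 2 * (α * (H ^ 2 * R)) :=
          mul_le_mul_of_nonneg_right hcb (by positivity)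
      _ = α * K / 2 := by rw [hKdef]; ring
      _ ≤ est / 2 := by linarith
  -- The penalty eats at most est/2 ≤ a/2 + ε/32, and a ≥ 15/16 aPlus; what remains is 15/32 - 1/32
  -- = 7/16.
  have h2 : 7 / 16 * aPlus ≤ a - c * (α * (H ^ 2 * R)) := by linarith
  calc 49 / 128 * aPlus ^ 2 * p / (b * H * R)
      = 7 / 8 * aPlus / K * (H * p) * (7 / 16 * aPlus) := by rw [hKdef]; field_simp; ring
    _ ≤ α * (H * p) * (a - c * (α * (H ^ 2 * R))) :=
        mul_le_mul (mul_le_mul_of_nonneg_right hα0 (by positivity)) h2 (by positivity)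
          (by positivity)
    _ = α * (H * p * a) - c * α ^ 2 * R * H ^ 3 * p := by ring
    _ ≤ G := hG

variable {X Y : Type*} [MeasurableSpace X] [Fintype Y] [MeasurableSpace Y]
  [MeasurableSingletonClass Y] {H : ℕ} {M : MDP X Y H} {R : ℝ}

theorem measurable_uncurry_of_slices {g : Fin H → X → Y → ℝ}
    (hg : ∀ h y, Measurable fun x => g h x y) :
    Measurable fun z : (Fin H × X) × Y => g z.1.1 z.1.2 z.2 :=
  measurable_from_prod_countable_left fun y =>
    measurable_from_prod_countable_right (f := fun w : Fin H × X => g w.1 w.2 y) fun h => hg h y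

theorem DetPolicy.sum_toPolicy_mul (d : DetPolicy X Y H) (h : Fin H) (x : X) (g : Y → ℝ) :
    ∑ y, d.toPolicy.prob h x y * g y = g (d.act h x) := by
  classical
  simp [DetPolicy.toPolicy]

theorem DetPolicy.measurable_uncurry_act (d : DetPolicy X Y H) :
    Measurable fun s : Fin H × X => d.act s.1 s.2 :=
  measurable_from_prod_countable_right fun h => d.measurable_act h

/-! ### Advantages under the on-policy law and under the credit sampler. -/

namespace MDP

variable (π : Policy X Y H)

theorem integral_onPolicy {g : Fin H × X → ℝ} (hg : Measurable g) {c : ℝ} (hc : ∀ s, |g s| ≤ c) :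
    ∫ s, g s ∂(M.onPolicy π) = (1 / (H : ℝ)) * ∑ h : Fin H, ∫ x, g (h, x) ∂(M.stateLaw π h) := by
  have hmk : ∀ h : Fin H, Measurable (Prod.mk h : X → Fin H × X) := fun h => measurable_prodMk_left
  rw [onPolicy, integral_smul_measure, integral_finsetSum_measure fun h _ => by
    have := Measure.isProbabilityMeasure_map (μ := M.stateLaw π h) (hmk h).aemeasurable
    exact integrable_of_abs_le hg hc]
  simp only [smul_eq_mul, ENNReal.toReal_inv, ENNReal.toReal_natCast, one_div]
  congr 1
  exact Finset.sum_congr rfl fun h _ =>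
    integral_map (hmk h).aemeasurable hg.aestronglyMeasurable

theorem isProbabilityMeasure_onPolicy (hH : 1 ≤ H) : IsProbabilityMeasure (M.onPolicy π) := by
  refine ⟨?_⟩
  have : ∀ h : Fin H, ((M.stateLaw π h).map (Prod.mk h)) Set.univ = 1 := fun h => by
    have := Measure.isProbabilityMeasure_map (μ := M.stateLaw π h)
      (f := Prod.mk h) measurable_prodMk_left.aemeasurable
    exact measure_univ
  simp only [onPolicy, Measure.smul_apply, Measure.coe_finsetSum, Finset.sum_apply, this,
    Finset.sum_const, Finset.card_univ, Fintype.card_fin, nsmul_eq_mul, mul_one, smul_eq_mul]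
  exact ENNReal.inv_mul_cancel (by simp; omega) (by simp)

theorem measurableSet_improvablePairs (M : MDP X Y H) (π : Policy X Y H) (τ : ℝ) :
    MeasurableSet (M.improvablePairs π τ) := by
  have : M.improvablePairs π τ = ⋃ h, (Prod.fst ⁻¹' {h}) ∩ (Prod.snd ⁻¹' (M.improvable π τ h)) := by
    ext s; simp [improvablePairs]
  rw [this]
  exact MeasurableSet.iUnion fun h => (measurable_fst (measurableSet_singleton h)).inter
    (measurable_snd (M.measurableSet_improvable π τ h))

theorem setIntegral_improvablePairs (τ : ℝ) {g : Fin H × X → ℝ} (hg : Measurable g)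
    {c : ℝ} (hc : ∀ s, |g s| ≤ c) :
    ∫ s in M.improvablePairs π τ, g s ∂(M.onPolicy π) = (1 / (H : ℝ)) * ∑ h : Fin H,
      ∫ x, (M.improvable π τ h).indicator (fun x => g (h, x)) x ∂(M.stateLaw π h) := by
  rw [← integral_indicator (M.measurableSet_improvablePairs π τ),
    integral_onPolicy π (hg.indicator (M.measurableSet_improvablePairs π τ)) (c := c)]
  · rfl
  · intro s
    by_cases hs : s ∈ M.improvablePairs π τ
    · simpa [hs] using hc s
    · simpa [hs] using (abs_nonneg _).trans (hc s)

theorem onPolicy_real_improvablePairs (τ : ℝ) :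
    (M.onPolicy π).real (M.improvablePairs π τ) = M.coverage π τ := by
  have h := setIntegral_improvablePairs (M := M) π τ (g := fun _ => 1) measurable_const
    (c := 1) (by simp)
  rw [setIntegral_const, smul_eq_mul, mul_one] at h
  rw [h, coverage]
  congr 1
  refine Finset.sum_congr rfl fun h _ => ?_
  rw [integral_indicator (M.measurableSet_improvable π τ h), setIntegral_const, smul_eq_mul,
    mul_one]

theorem coverage_le_one (hH : 1 ≤ H) (τ : ℝ) : M.coverage π τ ≤ 1 := by
  have := isProbabilityMeasure_onPolicy (M := M) π hH
  rw [← onPolicy_real_improvablePairs π]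
  exact measureReal_le_one

/-- The advantage of a deterministic policy under a law of `(h, x)`. -/
noncomputable def advantageOn (M : MDP X Y H) (π : Policy X Y H) (ν : Measure (Fin H × X))
    (d : DetPolicy X Y H) : ℝ :=
  ∫ s, M.A π s.1 s.2 (d.act s.1 s.2) ∂ν

theorem measurable_A_act (M : MDP X Y H) (π : Policy X Y H) (d : DetPolicy X Y H) :
    Measurable fun s : Fin H × X => M.A π s.1 s.2 (d.act s.1 s.2) :=
  (measurable_uncurry_of_slices (M.measurable_A π)).comp
    (measurable_id.prodMk d.measurable_uncurry_act)

section Bounded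

variable {π} (hR : ∀ h x y, M.reward h x y ∈ Set.Icc 0 R)

include hR

theorem abs_A_le_mul (hR0 : 0 ≤ R) (h : Fin H) (x : X) (y : Y) : |M.A π h x y| ≤ H * R :=
  (abs_A_le π hR h x y).trans
    (mul_le_mul_of_nonneg_right (by exact_mod_cast Nat.sub_le _ _) hR0)

theorem A_greedy_nonneg {d : DetPolicy X Y H} (hd : IsGreedy (M.A π) d) (h : Fin H) (x : X) :
    0 ≤ M.A π h x (d.act h x) := by
  have h0 : ∑ y, π.prob h x y * M.A π h x y = 0 := by rw [sum_prob_mul_A π hR, sub_self]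
  rw [← h0]
  calc ∑ y, π.prob h x y * M.A π h x y ≤ ∑ y, π.prob h x y * M.A π h x (d.act h x) :=
        Finset.sum_le_sum fun y _ => mul_le_mul_of_nonneg_left (hd h x y) (π.prob_nonneg h x y)
    _ = M.A π h x (d.act h x) := by rw [← Finset.sum_mul, π.sum_prob, one_mul]

/-- Advantages never exceed H R, so a larger threshold would leave the improvable sets empty. This
is what makes ε ≤ B available, and with τ > 0 it forces R > 0. -/
theorem threshold_le (hR0 : 0 ≤ R) {τ : ℝ} (hcov : 0 < M.coverage π τ) : τ ≤ H * R := by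
  by_contra hlt
  have : ∀ h, M.improvable π τ h = ∅ := fun h => by
    refine Set.eq_empty_of_forall_notMem fun x ⟨y, hy⟩ => hlt ?_
    exact hy.trans ((le_abs_self _).trans (abs_A_le_mul hR hR0 h x y))
  simp [coverage, this] at hcov

theorem policyAdvantage_eq_advantageOn (hR0 : 0 ≤ R) (d : DetPolicy X Y H) :
    M.policyAdvantage π d.toPolicy = M.advantageOn π (M.onPolicy π) d := by
  rw [advantageOn, integral_onPolicy π (measurable_A_act M π d)
    (fun s => abs_A_le_mul hR hR0 s.1 s.2 _), policyAdvantage]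
  simp_rw [DetPolicy.sum_toPolicy_mul]

theorem abs_advantageOn_le (hR0 : 0 ≤ R) (ν : Measure (Fin H × X)) [IsProbabilityMeasure ν]
    (d : DetPolicy X Y H) : |M.advantageOn π ν d| ≤ H * R := by
  simpa [advantageOn] using norm_integral_le_of_norm_le_const (μ := ν)
    (f := fun s => M.A π s.1 s.2 (d.act s.1 s.2))
    (Filter.Eventually.of_forall fun s => abs_A_le_mul hR hR0 s.1 s.2 _)

/-- The greedy advantage is at least τ on the improvable pairs and nonnegative elsewhere, as in
Markov's inequality. -/
theorem threshold_mul_coverage_le (hH : 1 ≤ H) (hR0 : 0 ≤ R) {τ : ℝ} {d : DetPolicy X Y H}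
    (hd : IsGreedy (M.A π) d) :
    τ * M.coverage π τ ≤ M.advantageOn π (M.onPolicy π) d := by
  have := isProbabilityMeasure_onPolicy (M := M) π hH
  have hm := M.measurableSet_improvablePairs π τ
  rw [← onPolicy_real_improvablePairs π, mul_comm, ← smul_eq_mul, ← setIntegral_const,
    ← integral_indicator hm]
  refine integral_mono ((integrable_const _).indicator hm) (integrable_of_abs_le
    (measurable_A_act M π d) fun s => abs_A_le_mul hR hR0 s.1 s.2 _) fun s => ?_
  by_cases hs : s ∈ M.improvablePairs π τ
  · rw [Set.indicator_of_mem hs]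
    obtain ⟨y, hy⟩ := hs
    exact hy.trans (hd s.1 s.2 y)
  · simpa [hs] using A_greedy_nonneg hR hd s.1 s.2

theorem isProbabilityMeasure_creditSampler (hH : 1 ≤ H) {τ : ℝ} (hcov : 0 < M.coverage π τ) :
    IsProbabilityMeasure (M.creditSampler π τ) := by
  have := isProbabilityMeasure_onPolicy (M := M) π hH
  refine cond_isProbabilityMeasure fun h0 => ?_
  rw [← onPolicy_real_improvablePairs π, Measure.real, h0] at hcov
  simp at hcov

theorem threshold_le_advantageOn_creditSampler (hH : 1 ≤ H) (hR0 : 0 ≤ R) {τ : ℝ}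
    (hcov : 0 < M.coverage π τ) {d : DetPolicy X Y H} (hd : IsGreedy (M.A π) d) :
    τ ≤ M.advantageOn π (M.creditSampler π τ) d := by
  have := isProbabilityMeasure_creditSampler hR hH hcov
  have hae : ∀ᵐ s ∂(M.creditSampler π τ), τ ≤ M.A π s.1 s.2 (d.act s.1 s.2) := by
    filter_upwards [ae_cond_mem (μ := M.onPolicy π) (M.measurableSet_improvablePairs π τ)]
      with s ⟨y, hy⟩
    exact hy.trans (hd s.1 s.2 y)
  calc τ = ∫ _, τ ∂(M.creditSampler π τ) := by simp
    _ ≤ _ := integral_mono_ae (integrable_const _) (integrable_of_abs_le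
      (measurable_A_act M π d) fun s => abs_A_le_mul hR hR0 s.1 s.2 _) hae

/-- Undoing the conditioning costs the factor p_π, and undoing the uniform time the factor H. The
right side is the linear term of the gain. -/
theorem mul_coverage_mul_advantageOn_creditSampler (hH : 1 ≤ H) (hR0 : 0 ≤ R) {τ : ℝ}
    (hcov : 0 < M.coverage π τ) (d : DetPolicy X Y H) :
    H * M.coverage π τ * M.advantageOn π (M.creditSampler π τ) d
      = ∑ h : Fin H, ∫ x, (M.improvable π τ h).indicator
          (fun x => ∑ y, d.toPolicy.prob h x y * M.A π h x y) x ∂(M.stateLaw π h) := by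
  have hH0 : (H : ℝ) ≠ 0 := by positivity
  rw [advantageOn, creditSampler, ProbabilityTheory.cond, integral_smul_measure, setIntegral_improvablePairs π τ
    (measurable_A_act M π d) (fun s => abs_A_le_mul hR hR0 s.1 s.2 _), ENNReal.toReal_inv]
  have e : ((M.onPolicy π) (M.improvablePairs π τ)).toReal = M.coverage π τ :=
    onPolicy_real_improvablePairs π τ
  rw [e, smul_eq_mul]
  simp_rw [DetPolicy.sum_toPolicy_mul]
  field_simp

end Bounded

end MDP

/-! ### The sampling event for the algorithm. -/

/-- For x = 2m/δ ≥ 2 one has 5x/2 ≤ x³. This is the source of the factor 3 in the absolute constant.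
-/
theorem log_five_mul_div_le {m δ : ℝ} (hm : 1 ≤ m) (hδ : 0 < δ) (hδ1 : δ < 1) :
    0 < Real.log (2 * m / δ) ∧ Real.log (5 * m / δ) ≤ 3 * Real.log (2 * m / δ) := by
  have h1 : 2 ≤ 2 * m / δ := by rw [le_div_iff₀ hδ]; nlinarith
  refine ⟨Real.log_pos (by linarith), ?_⟩
  have h3 : (3 : ℝ) * Real.log (2 * m / δ) = Real.log ((2 * m / δ) ^ 3) := by
    rw [Real.log_pow]; norm_num
  rw [h3]
  refine Real.log_le_log (by positivity) ?_
  have e : 5 * m / δ = 5 / 2 * (2 * m / δ) := by ring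
  rw [e]
  nlinarith [mul_self_nonneg (2 * m / δ - 2)]

/-- With high probability, every least-squares fit yields an accurate advantage estimate and a
nearly optimal greedy policy. -/
theorem exists_sampling_event (hR : ∀ h x y, M.reward h x y ∈ Set.Icc 0 R) (hR0 : 0 < R)
    (hH : 1 ≤ H) (π : Policy X Y H) {F : Finset (Fin H → X → Y → ℝ)}
    {sel : (Fin H → X → Y → ℝ) → DetPolicy X Y H}
    (hF : ∀ f ∈ F, ∀ h y, Measurable fun x => f h x y) (hQ : M.Q π ∈ F)
    (hsel : ∀ f ∈ F, IsGreedy f (sel f)) {δ ε : ℝ} (hδ : δ ∈ Set.Ioo (0 : ℝ) 1) (hε : 0 < ε)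
    (hεR : ε ≤ H * R) (ν : Measure (Fin H × X)) [IsProbabilityMeasure ν] {n : ℕ}
    (hn : N₀ (3 * 2 ^ 20) (Fintype.card Y) H R F.card δ ≤ ε ^ 2 * n) :
    ∃ E : Set (Fin n → ((Fin H × X) × Y) × ℝ), MeasurableSet E ∧
      1 - δ ≤ (M.dataLaw π ν n).real E ∧
      ∀ D ∈ E, ∀ f, IsLeastSquares F D f →
        |advEstimate π (sel f).toPolicy f D - M.advantageOn π ν (sel f)| ≤ ε / 16 ∧
        ∀ d, M.advantageOn π ν d - M.advantageOn π ν (sel f) ≤ ε / 16 := by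
  have hB : 0 < (H : ℝ) * R := by positivity
  obtain ⟨s0⟩ := ν.nonempty_of_neZero
  have hY : Nonempty Y := ⟨(sel (M.Q π)).act s0.1 s0.2⟩
  have hm : (1 : ℝ) ≤ F.card := by exact_mod_cast Finset.card_pos.2 ⟨_, hQ⟩
  have hk : (1 : ℝ) ≤ Fintype.card Y := by exact_mod_cast Fintype.card_pos
  obtain ⟨hL, hl⟩ := log_five_mul_div_le hm hδ.1 hδ.2
  rw [N₀] at hn
  have hn0 : 0 < n := by
    rcases Nat.eq_zero_or_pos n with rfl | h
    · have : 0 < 3 * 2 ^ 20 * (Fintype.card Y : ℝ) * (H : ℝ) ^ 2 * R ^ 2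
          * Real.log (2 * F.card / δ) := by positivity
      simp at hn; linarith
    · exact h
  have hN : 2 ^ 20 * Fintype.card Y * ((H : ℝ) * R) ^ 2 * Real.log (5 * F.card / δ)
      ≤ ε ^ 2 * n := by
    have := mul_le_mul_of_nonneg_left hl
      (by positivity : 0 ≤ 2 ^ 20 * (Fintype.card Y : ℝ) * ((H : ℝ) * R) ^ 2)
    refine this.trans (le_trans (le_of_eq ?_) hn)
    ring
  have hbd : ∀ h : Fin H, ((H - h : ℕ) : ℝ) * R ≤ H * R := fun h =>
    mul_le_mul_of_nonneg_right (by exact_mod_cast Nat.sub_le _ _) hR0.le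
  have hqB : ∀ z : (Fin H × X) × Y, M.Q π z.1.1 z.1.2 z.2 ∈ Set.Icc 0 ((H : ℝ) * R) := fun z =>
    ⟨(MDP.Q_mem π hR z.1.1 z.1.2 z.2).1, (MDP.Q_mem π hR z.1.1 z.1.2 z.2).2.trans (hbd _)⟩
  obtain ⟨E, hE, hEP, hED⟩ := exists_regression_event (n := n) F
    (f := fun f z => f z.1.1 z.1.2 z.2) (d := fun f s => (sel f).act s.1 s.2)
    (p := fun z => π.prob z.1.1 z.1.2 z.2) (ν := ν) (κ := M.rolloutKernel π)
    (q := fun z => M.Q π z.1.1 z.1.2 z.2)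
    hB hε hεR hn0 hδ.1 ⟨_, hQ⟩ hN
    (fun z => (MDP.qRollout_mem π hR z.1.1 (z.1.2, z.2)).mono
      fun r hr => ⟨hr.1, hr.2.trans (hbd _)⟩)
    (fun z => (MDP.integral_qRollout π hR z.1.1 z.1.2 z.2).symm)
    (measurable_uncurry_of_slices (M.measurable_Q π)) hqB
    (measurable_uncurry_of_slices π.measurable_prob) (fun z => π.prob_nonneg _ _ _)
    (fun s => π.sum_prob s.1 s.2)
    (fun f hf => measurable_uncurry_of_slices (hF f hf))
    (fun f => (sel f).measurable_uncurry_act) (fun f hf s y => hsel f hf s.1 s.2 y)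
  have hadv : ∀ d : DetPolicy X Y H, M.advantageOn π ν d
      = ∫ s, (M.Q π s.1 s.2 (d.act s.1 s.2)
        - ∑ y, π.prob s.1 s.2 y * M.Q π s.1 s.2 y) ∂ν := fun d => by
    rw [MDP.advantageOn]
    refine integral_congr_ae (Filter.Eventually.of_forall fun s => ?_)
    simp only [MDP.A]
    rw [MDP.V_eq_sum π hR]
  refine ⟨E, hE, hEP, fun D hD f hf => ?_⟩
  obtain ⟨h1, h2⟩ := hED D hD f hf.1 (hf.2 _ hQ)
  refine ⟨?_, fun d => ?_⟩
  · rw [hadv]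
    exact h1
  · refine le_trans (le_of_eq ?_) (h2 _ d.measurable_uncurry_act)
    have hint : ∀ d : DetPolicy X Y H,
        Integrable (fun s : Fin H × X => M.A π s.1 s.2 (d.act s.1 s.2)) ν := fun d =>
      integrable_of_abs_le (MDP.measurable_A_act M π d)
        fun s => MDP.abs_A_le_mul hR hR0.le s.1 s.2 _
    rw [MDP.advantageOn, MDP.advantageOn, ← integral_sub (hint d) (hint _)]
    exact integral_congr_ae (Filter.Eventually.of_forall fun s => by simp [MDP.A])

/-! ### The tightness example. -/

/-- The two-state MDP whose states are absorbing; the action `true` earns `a` in the state `true`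
and `b` in the state `false`, and the state `true` has initial probability `p`. -/
noncomputable def absorbingMDP (H : ℕ) (p a b : ℝ) (hp : p ∈ Set.Icc (0 : ℝ) 1) :
    MDP Bool Bool H where
  init := ENNReal.ofReal p • Measure.dirac true + ENNReal.ofReal (1 - p) • Measure.dirac false
  isProbabilityMeasure_init := ⟨by
    simp [← ENNReal.ofReal_add hp.1 (sub_nonneg.2 hp.2)]⟩
  trans _ := Kernel.deterministic Prod.fst measurable_fst
  isMarkovKernel_trans _ := inferInstance
  reward _ x y := if y then (if x then a else b) else 0
  measurable_reward _ := measurable_of_finite _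

/-- The policy that always plays `y`. -/
def constPolicy (X : Type*) [MeasurableSpace X] (H : ℕ) (y : Bool) : DetPolicy X Bool H where
  act _ _ := y
  measurable_act _ := measurable_const

section Absorbing

variable {H : ℕ} {p a b R : ℝ} {hp : p ∈ Set.Icc (0 : ℝ) 1}

theorem integral_absorbingMDP_init (g : Bool → ℝ) :
    ∫ x, g x ∂(absorbingMDP H p a b hp).init = p * g true + (1 - p) * g false := by
  rw [absorbingMDP, integral_add_measure
    (Integrable.of_finite.smul_measure ENNReal.ofReal_ne_top)
    (Integrable.of_finite.smul_measure ENNReal.ofReal_ne_top),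
    integral_smul_measure, integral_smul_measure, integral_dirac, integral_dirac,
    ENNReal.toReal_ofReal hp.1, ENNReal.toReal_ofReal (sub_nonneg.2 hp.2)]
  rfl

theorem stateLaw_absorbingMDP (π : Policy Bool Bool H) {h : ℕ} (hh : h ≤ H) :
    (absorbingMDP H p a b hp).stateLaw π h = (absorbingMDP H p a b hp).init := by
  induction h with
  | zero => rfl
  | succ h ih =>
    rw [MDP.stateLaw_succ π hh, ih (by omega)]
    have : (absorbingMDP H p a b hp).trans ⟨h, hh⟩ ∘ₖ (Kernel.id ×ₖ π.kernel ⟨h, hh⟩)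
        = Kernel.id := by
      ext1 x
      rw [π.comp_id_prod_kernel_apply]
      simp only [absorbingMDP, Kernel.deterministic_apply, Kernel.id_apply]
      rw [← Finset.sum_smul, π.sum_ofReal_prob, one_smul]
    rw [this]
    exact Measure.bind_dirac

variable (hR : ∀ h x y, (absorbingMDP H p a b hp).reward h x y ∈ Set.Icc 0 R)

include hR

/-- The action `false` earns nothing in either state, so every return is zero and the advantages of
this policy are the immediate rewards. -/
theorem V_absorbingMDP (h : ℕ) (x : Bool) :
    (absorbingMDP H p a b hp).V (constPolicy Bool H false).toPolicy h x = 0 := by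
  by_cases hh : h < H
  · rw [MDP.V_eq_sum _ hR ⟨h, hh⟩ x, DetPolicy.sum_toPolicy_mul, MDP.Q]
    simp only [V_absorbingMDP (h + 1)]
    simp [absorbingMDP, constPolicy]
  · exact MDP.V_of_le _ (not_lt.1 hh) x
termination_by H - h

theorem A_absorbingMDP (h : Fin H) (x y : Bool) :
    (absorbingMDP H p a b hp).A (constPolicy Bool H false).toPolicy h x y
      = if y then (if x then a else b) else 0 := by
  rw [MDP.A, MDP.Q]
  simp only [V_absorbingMDP hR]
  simp [absorbingMDP]

theorem improvable_absorbingMDP (ha : 0 < a) (hb : b < a) (h : Fin H) :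
    (absorbingMDP H p a b hp).improvable (constPolicy Bool H false).toPolicy a h = {true} := by
  ext x
  simp only [MDP.improvable, A_absorbingMDP hR]
  cases x <;> simp [hb, ha]

theorem coverage_absorbingMDP (hH : 1 ≤ H) (ha : 0 < a) (hb : b < a) :
    (absorbingMDP H p a b hp).coverage (constPolicy Bool H false).toPolicy a = p := by
  have hH0 : (H : ℝ) ≠ 0 := by positivity
  have h1 : ∀ h : Fin H, ((absorbingMDP H p a b hp).stateLaw
      (constPolicy Bool H false).toPolicy h).real {true} = p := fun h => by
    rw [stateLaw_absorbingMDP _ h.2.le, ← integral_indicator_one (measurableSet_singleton _),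
      integral_absorbingMDP_init]
    simp
  simp only [MDP.coverage, improvable_absorbingMDP hR ha hb, h1]
  simp [hH0]

theorem policyAdvantage_absorbingMDP (hH : 1 ≤ H) :
    (absorbingMDP H p a b hp).policyAdvantage (constPolicy Bool H false).toPolicy
      (constPolicy Bool H true).toPolicy = p * a + (1 - p) * b := by
  have hH0 : (H : ℝ) ≠ 0 := by positivity
  have h1 : ∀ h : Fin H, (absorbingMDP H p a b hp).stateLaw
      (constPolicy Bool H false).toPolicy h = (absorbingMDP H p a b hp).init := fun h =>
    stateLaw_absorbingMDP _ h.2.le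
  simp only [MDP.policyAdvantage, DetPolicy.sum_toPolicy_mul, A_absorbingMDP hR, h1,
    integral_absorbingMDP_init]
  simp only [constPolicy, if_true, Finset.sum_const, Finset.card_univ, Fintype.card_fin,
    nsmul_eq_mul, Bool.false_eq_true, if_false]
  field_simp

theorem offAdvantage_absorbingMDP (hH : 1 ≤ H) (hp1 : p < 1) (ha : 0 < a) (hb : b < a) :
    (absorbingMDP H p a b hp).offAdvantage (constPolicy Bool H false).toPolicy
      (constPolicy Bool H true).toPolicy a = b := by
  set M := absorbingMDP H p a b hp with hM
  set π := (constPolicy Bool H false).toPolicy with hπ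
  have := MDP.isProbabilityMeasure_onPolicy (M := M) π hH
  have hm := M.measurableSet_improvablePairs π a
  have hprob : IsProbabilityMeasure (ProbabilityTheory.cond (M.onPolicy π)
      (M.improvablePairs π a)ᶜ) := by
    refine cond_isProbabilityMeasure fun h0 => ?_
    have h1 := probReal_compl_eq_one_sub (μ := M.onPolicy π) hm
    rw [MDP.onPolicy_real_improvablePairs, coverage_absorbingMDP hR hH ha hb, Measure.real, h0]
      at h1
    simp at h1
    linarith
  have hae : ∀ᵐ z ∂(ProbabilityTheory.cond (M.onPolicy π) (M.improvablePairs π a)ᶜ),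
      ∑ y, (constPolicy Bool H true).toPolicy.prob z.1 z.2 y * M.A π z.1 z.2 y = b := by
    filter_upwards [ae_cond_mem hm.compl] with z hz
    have hz2 : z.2 = false := by
      by_contra hne
      refine hz ?_
      change z.2 ∈ M.improvable π a z.1
      rw [improvable_absorbingMDP hR ha hb]
      simpa using hne
    rw [DetPolicy.sum_toPolicy_mul, A_absorbingMDP hR, hz2]
    simp [constPolicy]
  rw [MDP.offAdvantage, integral_congr_ae hae]
  simp

theorem isGreedy_absorbingMDP (ha : 0 ≤ a) (hb : 0 ≤ b) :
    IsGreedy ((absorbingMDP H p a b hp).A (constPolicy Bool H false).toPolicy)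
      (constPolicy Bool H true) := by
  intro h x y
  rw [A_absorbingMDP hR, A_absorbingMDP hR]
  cases x <;> cases y <;> simp [constPolicy, ha, hb]

end Absorbing

end CPI

/-! ### Assembly. -/

theorem theorem1 :
    -- guarantees of the two variants, with one absolute constant
    (∃ C : ℝ, 0 < C ∧
      ∀ (X Y : Type*) [MeasurableSpace X] [Fintype Y] [MeasurableSpace Y]
        [MeasurableSingletonClass Y] (H : ℕ) (M : MDP X Y H) (R τ δ : ℝ)
        (π : Policy X Y H) (piPlus : DetPolicy X Y H)
        (F : Finset (Fin H → X → Y → ℝ))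
        (sel : (Fin H → X → Y → ℝ) → DetPolicy X Y H),
        1 ≤ H →
        (∀ h x y, M.reward h x y ∈ Set.Icc 0 R) →
        0 < τ →
        0 < M.coverage π τ →
        δ ∈ Set.Ioo (0 : ℝ) 1 →
        IsGreedy (M.A π) piPlus →
        (∀ f ∈ F, ∀ h y, Measurable fun x => f h x y) →
        M.Q π ∈ F →
        (∀ f ∈ F, IsGreedy f (sel f)) →
        -- (a) random resets
        ((∀ n : ℕ, N₀ C (Fintype.card Y) H R F.card δ / (τ ^ 2 * M.coverage π τ ^ 2) ≤ n →
            ∃ E : Set (Fin n → ((Fin H × X) × Y) × ℝ), MeasurableSet E ∧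
              1 - δ ≤ (M.dataLaw π (M.onPolicy π) n).real E ∧
              ∀ D ∈ E, ∀ f, IsLeastSquares F D f →
                ∃ hα : stepRR R π (sel f).toPolicy f D ∈ Set.Icc (0 : ℝ) 1,
                  M.policyAdvantage π piPlus.toPolicy ^ 2 / (8 * H * R) ≤
                    M.J (outputRR π (sel f).toPolicy (stepRR R π (sel f).toPolicy f D) hα)
                      - M.J π) ∧
          τ ^ 2 * M.coverage π τ ^ 2 / (8 * H * R) ≤
            M.policyAdvantage π piPlus.toPolicy ^ 2 / (8 * H * R)) ∧
        -- (b) credit-assignment resets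
        (∀ n : ℕ, N₀ C (Fintype.card Y) H R F.card δ / τ ^ 2 ≤ n →
            ∃ E : Set (Fin n → ((Fin H × X) × Y) × ℝ), MeasurableSet E ∧
              1 - δ ≤ (M.dataLaw π (M.creditSampler π τ) n).real E ∧
              ∀ D ∈ E, ∀ f, IsLeastSquares F D f →
                ∃ hα : stepCARO R π (sel f).toPolicy f D ∈ Set.Icc (0 : ℝ) 1,
                  τ ^ 2 * M.coverage π τ / (16 * H * R) ≤
                    M.J (outputCARO M τ π (sel f).toPolicy
                      (stepCARO R π (sel f).toPolicy f D) hα) - M.J π)) ∧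
    -- tightness of the second inequality in (a) when the advantage off the improvable set is
    -- a small fraction `ε` of `τ`
    (∀ (H : ℕ) (R τ p ε : ℝ), 1 ≤ H → 0 < τ → τ ≤ R → 0 < p → p < 1 → 0 ≤ ε → ε < 1 →
      ∃ (M : MDP Bool Bool H) (π : Policy Bool Bool H) (piPlus : DetPolicy Bool Bool H),
        (∀ h x y, M.reward h x y ∈ Set.Icc 0 R) ∧
        IsGreedy (M.A π) piPlus ∧
        M.coverage π τ = p ∧
        M.offAdvantage π piPlus.toPolicy τ = ε * τ ∧
        M.policyAdvantage π piPlus.toPolicy ^ 2 / (8 * H * R) =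
          (1 + ε * (1 - p) / p) ^ 2 * (τ ^ 2 * p ^ 2 / (8 * H * R))) := by
  refine ⟨⟨3 * 2 ^ 20, by norm_num, ?_⟩, ?_⟩
  · intro X Y _ _ _ _ H M R τ δ π piPlus F sel hH hR hτ hcov hδ hgreedy hF hQ hsel
    have hH1 : (1 : ℝ) ≤ H := by exact_mod_cast hH
    have hprob := MDP.isProbabilityMeasure_onPolicy (M := M) π hH
    have hR0' : 0 ≤ R := by
      obtain ⟨s⟩ := (M.onPolicy π).nonempty_of_neZero
      have := hR s.1 s.2 (piPlus.act s.1 s.2)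
      exact this.1.trans this.2
    have hτR := MDP.threshold_le hR hR0' hcov
    have hR0 : 0 < R := by
      rcases hR0'.eq_or_lt with h | h
      · rw [← h] at hτR; linarith
      · exact h
    have hcov1 := MDP.coverage_le_one (M := M) π hH τ
    have hτp := MDP.threshold_mul_coverage_le hR hH hR0.le (τ := τ) hgreedy
    rw [MDP.policyAdvantage_eq_advantageOn hR hR0.le]
    set p := M.coverage π τ with hp
    have hτp0 : 0 < τ * p := mul_pos hτ hcov
    refine ⟨⟨fun n hn => ?_, ?_⟩, fun n hn => ?_⟩
    · rw [← mul_pow, div_le_iff₀' (by positivity)] at hn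
      obtain ⟨E, hE, hEP, hED⟩ := exists_sampling_event hR hR0 hH π hF hQ hsel hδ hτp0
        ((mul_le_of_le_one_right hτ.le hcov1).trans hτR) (M.onPolicy π) hn
      refine ⟨E, hE, hEP, fun D hD f hf => ?_⟩
      obtain ⟨hest, hgap⟩ := hED D hD f hf
      -- The penalty is 2α²R·H³/4, hence c = 1/2, matching b = 1. The resulting 49/128 leaves room
      -- above the required 1/8. The gain G stays free because the output policy can be formed only
      -- once α is known to lie in [0, 1].
      have hstep := fun (G : ℝ) => sq_le_of_step (G := G) (p := 1) (b := 1) (c := 1 / 2)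
        (α := stepRR R π (sel f).toPolicy f D) hH1 hR0
        zero_le_one le_rfl hτp0 hτp (hgap piPlus) hest
        ((le_abs_self _).trans (MDP.abs_advantageOn_le hR hR0.le _ _)) (by norm_num)
        (by rw [stepRR, one_mul])
      have hα := (hstep _ le_rfl).1
      refine ⟨hα, ?_⟩
      have hgain := le_J_mixOn_sub_J (M := M) π (sel f).toPolicy (S := fun _ => Set.univ)
        (fun _ => MeasurableSet.univ) hα hR (w := fun _ => 1) (fun h => by simp)
      have hsum : ∑ h : Fin H, ∫ x, (Set.univ : Set X).indicator
          (fun x => ∑ y, (sel f).toPolicy.prob h x y * M.A π h x y) x ∂(M.stateLaw π h)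
          = H * 1 * M.advantageOn π (M.onPolicy π) (sel f) := by
        rw [← MDP.policyAdvantage_eq_advantageOn hR hR0.le, MDP.policyAdvantage]
        simp only [Set.indicator_univ]
        field_simp
      rw [hsum] at hgain
      simp only [Finset.sum_const, Finset.card_range, nsmul_eq_mul, mul_one] at hgain
      have hcube := mul_le_mul_of_nonneg_left (sum_sub_mul_le_cube H)
        (by positivity : 0 ≤ 2 * (stepRR R π (sel f).toPolicy f D) ^ 2 * R)
      refine le_trans ?_ ((hstep _ ?_).2.trans (le_refl _))
      · rw [mul_one, one_mul, div_le_div_iff₀ (by positivity) (by positivity)]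
        have : 0 ≤ M.advantageOn π (M.onPolicy π) piPlus ^ 2 * (H * R) := by positivity
        linarith
      · rw [outputRR]
        linarith
    · refine div_le_div_of_nonneg_right ?_ (by positivity)
      rw [← mul_pow]
      exact pow_le_pow_left₀ hτp0.le hτp 2
    · rw [div_le_iff₀' (by positivity)] at hn
      have hprob' := MDP.isProbabilityMeasure_creditSampler hR hH hcov
      obtain ⟨E, hE, hEP, hED⟩ := exists_sampling_event hR hR0 hH π hF hQ hsel hδ hτ
        hτR (M.creditSampler π τ) hn
      refine ⟨E, hE, hEP, fun D hD f hf => ?_⟩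
      obtain ⟨hest, hgap⟩ := hED D hD f hf
      have hτA := MDP.threshold_le_advantageOn_creditSampler hR hH hR0.le hcov hgreedy
      -- The penalty is 2α²R·(H²/2)·Hp, hence c = 1. The condition c ≤ b/2 asks for b = 2, the extra
      -- factor in the denominator of the step size; 49/256 exceeds 1/16.
      have hstep := fun (G : ℝ) => sq_le_of_step (G := G) (p := p) (b := 2) (c := 1)
        (α := stepCARO R π (sel f).toPolicy f D) hH1 hR0
        hcov.le one_le_two hτ hτA (hgap piPlus) hest
        ((le_abs_self _).trans (MDP.abs_advantageOn_le hR hR0.le _ _)) (by norm_num) rfl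
      have hα := (hstep _ le_rfl).1
      refine ⟨hα, ?_⟩
      let w : ℕ → ℝ := fun t =>
        if ht : t < H then (M.stateLaw π t).real (M.improvable π τ ⟨t, ht⟩) else 0
      have hw0 : ∀ t, 0 ≤ w t := fun t => by
        by_cases ht : t < H <;> simp [w, ht]
      have hwp : ∑ t ∈ Finset.range H, w t = H * p := by
        rw [← Fin.sum_univ_eq_sum_range, hp, MDP.coverage]
        simp only [w, Fin.is_lt, dif_pos, Fin.eta]
        field_simp
      have hgain := le_J_mixOn_sub_J (M := M) π (sel f).toPolicy
        (M.measurableSet_improvable π τ) hα hR (w := w) (fun h => by simp [w])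
      rw [← MDP.mul_coverage_mul_advantageOn_creditSampler hR hH hR0.le hcov, ← hp] at hgain
      have hsum := sum_sub_mul_le_of_le (H := H) (s := fun h => ∑ t ∈ Finset.range h, w t)
        (W := H * p) (by simp) (by positivity) fun h hh => by
          rw [← hwp]
          exact Finset.sum_le_sum_of_subset_of_nonneg
            (Finset.range_mono hh.le) fun t _ _ => hw0 t
      have hcube := mul_le_mul_of_nonneg_left hsum
        (by positivity : 0 ≤ 2 * (stepCARO R π (sel f).toPolicy f D) ^ 2 * R)
      refine le_trans ?_ (hstep _ ?_).2
      · rw [div_le_div_iff₀ (by positivity) (by positivity)]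
        have h1 : τ ^ 2 ≤ M.advantageOn π (M.creditSampler π τ) piPlus ^ 2 :=
          pow_le_pow_left₀ hτ.le hτA 2
        have h2 := mul_le_mul_of_nonneg_right h1 (by positivity : 0 ≤ p * (H * R))
        have h3 : 0 ≤ τ ^ 2 * (p * (H * R)) := by positivity
        linarith
      · rw [outputCARO]
        linarith
  · intro H R τ p ε hH hτ hτR hp0 hp1 hε0 hε1
    have hp : p ∈ Set.Icc (0 : ℝ) 1 := ⟨hp0.le, hp1.le⟩
    have hετ : ε * τ < τ := mul_lt_of_lt_one_left hτ hε1
    have hετ0 : 0 ≤ ε * τ := mul_nonneg hε0 hτ.le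
    -- The two states have advantages τ and ετ, with weights p and 1 - p. As ε < 1, only the first
    -- is improvable, and the advantage is pτ + (1 - p)ετ = (1 + ε(1 - p)/p)τp.
    have hR : ∀ h x y, (absorbingMDP H p τ (ε * τ) hp).reward h x y ∈ Set.Icc 0 R := by
      intro h x y
      cases x <;> cases y <;> simp [absorbingMDP] <;>
        first | linarith | constructor <;> linarith
    refine ⟨absorbingMDP H p τ (ε * τ) hp, (constPolicy Bool H false).toPolicy,
      constPolicy Bool H true, hR, isGreedy_absorbingMDP hR hτ.le hετ0,
      coverage_absorbingMDP hR hH hτ hετ, offAdvantage_absorbingMDP hR hH hp1 hτ hετ, ?_⟩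
    rw [policyAdvantage_absorbingMDP hR hH]
    field_simp
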